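/- **Tree stack automata.** Let $\Gamma$ be a finite alphabet and $@\notin\Gamma$. A *tree stack* over $\Gamma$ is a pair $(\xi,\rho)$ where $\xi$ is a partial function from $\mathbb N_+^*$ to $\Gamma\cup\{@\}$ with finite prefix-closed domain, mapping $\varepsilon$ (and only $\varepsilon$) to $@$, and $\rho\in\mathrm{dom}(\xi)$ (the *stack pointer*). Predicates are $\mathrm{bottom}=\{\rho=\varepsilon\}$, $\mathrm{equals}(\gamma)=\{\xi(\rho)=\gamma\}$ for $\gamma\in\Gamma$, and the set of all tree stacks; for $\gamma \in \Gamma\cup\{@\}$ we write $\gamma\in p$ if the tree stacks with symbol $\gamma$ at the pointer belong to $p$. Instructions are $\mathrm{id}$; $\mathrm{push}_n(\gamma)$ (if $\rho n\notin\mathrm{dom}(\xi)$: label $\rho n$ with $\gamma$ and move there); $\mathrm{up}_n$ (if $\rho n\in\mathrm{dom}(\xi)$: move there); $\mathrm{down}$ (if $\rho\ne\varepsilon$: move to the parent); $\mathrm{set}(\gamma)$ (if $\rho\neq\varepsilon$: relabel $\rho$ with $\gamma$), for $n\in\mathbb N_+$, $\gamma\in\Gamma$. A *tree stack automaton* (TSA)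 $\mathcal M$ over the finite alphabet $\Sigma$ has a finite state set $Q$, an initial state $q_{\mathrm i}$, final states $Q_{\mathrm f}\subseteq Q$, and a finite set $\delta$ of transitions $(q,\omega,p,f,q')$ with $q,q'\in Q$, $\omega\in\Sigma\cup\{\varepsilon\}$, $p$ a predicate, $f$ an instruction. Runs are sequences $\theta\in\delta^*$ of successively applicable transitions; $[\![\theta]\!]\in\Sigma^*$ is the word read; $\theta$ is *valid* if it leads from $q_{\mathrm i}$ and the root-only tree stack to some final state; $L(\mathcal M)=\{[\![\theta]\!]\mid\theta\text{ valid}\}$. Let $R(q,q')^{\gamma\to\gamma'}$ be the set of runs from $q$ to $q'$, starting in any tree stack, that use only $\mathrm{id}$- and $\mathrm{set}$-instructions and start with symbol $\gamma$ and end with symbol $\gamma'$ at the pointer. $\mathcal M$ is *cycle-free* if $R(q,q)^{\gamma\to\gamma}=\{\varepsilon\}$ for all $q\in Q$, $\gamma\in\Gamma\cup\{@\}$; *$k$-restricted* if in every valid run every position is entered by at most $k$ executions of $\mathrm{push}$- or $\mathrm{up}$-instructions; in *stack normal form* if the stack pointer is $\varepsilon$ whenever a run from the initial configuration reaches a final state.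 **Grammars.** A *$k$-MCFG* has a finite set $N$ of nonterminals with sorts in $\mathbb N_+$, a finite terminal alphabet, initial nonterminals of sort $1$, and finitely many rules $A\to[u_1,\dots,u_s](B_1,\dots,B_m)$ where $s\le k$ is the sort of $A$ and the $u_i$ are strings over terminals and variables $x_i^j$ ($1\le i\le m$, $1\le j\le \mathrm{sort}(B_i)$), each variable occurring at most once in $u_1\cdots u_s$. Derivations generate tuples of words by substituting the $j$-th component of the tuple generated from $B_i$ for $x_i^j$; the language consists of the words generated from initial nonterminals. **Construction.** Let $k\ge1$. Set - $\Omega^{\uparrow}(q,q';\gamma,\gamma';j,\beta)$: all runs $\sigma\tau$ with $\sigma\in R(q,\bar q)^{\gamma\to\gamma'}$ and $\tau\in\delta$ from $\bar q$ to $q'$ with instruction $\mathrm{push}_j(\beta)$ or $\mathrm{up}_j$ and predicate containing $\gamma'$; - $\Omega^{\downarrow}(q,q';\gamma,\gamma';\beta')$, respectively $\Omega^{\downarrow\uparrow}(q,q';\gamma,\gamma';\beta',j,\beta)$: all $\tau\sigma$ with $\tau\in\delta$ a $\mathrm{down}$-transition from $q$ to some $\bar q$ whose predicate contains $\beta'$,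 and $\sigma\in R(\bar q,q')^{\gamma\to\gamma'}$, respectively $\sigma\in\Omega^{\uparrow}(\bar q,q';\gamma,\gamma';j,\beta)$. A tuple $t=(\theta_0,\dots,\theta_\ell)$ is *admissible* of type $\langle q_1,q_2;\gamma,\gamma'\rangle$ with gaps $(p_i,p_i';j_i,\beta_i,\beta_i')_{1\le i\le\ell}$ if either $\ell=0$ and $\theta_0\in R(q_1,q_2)^{\gamma\to\gamma'}$, or $\ell\ge1$ and there are symbols $\gamma=g_0,g_1,\dots,g_{\ell+1}=\gamma'$ in $\Gamma\cup\{@\}$ with $\theta_0\in\Omega^\uparrow(q_1,p_1;g_0,g_1;j_1,\beta_1)$, $\theta_i\in\Omega^{\downarrow\uparrow}(p_i',p_{i+1};g_i,g_{i+1};\beta_i',j_{i+1},\beta_{i+1})$ for $1\le i<\ell$, and $\theta_\ell\in\Omega^\downarrow(p_\ell',q_2;g_\ell,g_{\ell+1};\beta_\ell')$. A sequence $T=(t_1,\dots,t_s)$, $s\ge1$, of such tuples (with chosen gaps) is *admissible* if there are $q_i,q_i'$ and $\gamma_0,\dots,\gamma_s$ such that $t_i$ has type $\langle q_i,q_i';\gamma_{i-1},\gamma_i\rangle$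 for all $i$; reading all gaps of $T$ left to right, the run before a gap ends with a $\mathrm{push}$ if and only if this gap is the first one with its number $j$; and for consecutive gaps with the same number $j$ the $\beta'$ of the former is the $\beta$ of the latter. Let $j^{(1)},\dots,j^{(m)}$ be the distinct gap numbers in order of first occurrence. The rule of $T$ is $A\to[u_1,\dots,u_s](B_1,\dots,B_m)$ where $A=\langle q_1,q_1',\dots,q_s,q_s';\gamma_0,\dots,\gamma_s\rangle$ (of sort $s$); $B_\kappa=\langle p_1,p_1',\dots,p_n,p_n';\beta_1,\beta_1',\dots,\beta_n'\rangle$ for the gaps $(p_i,p_i';j^{(\kappa)},\beta_i,\beta_i')_{1\le i\le n}$ of $T$ with number $j^{(\kappa)}$, in order; and $u_i$ is the concatenation of the runs of $t_i$ in which the $\nu$-th gap of $T$ with number $j^{(\kappa)}$ is filled by the variable $x_\kappa^\nu$. The grammar $G'(\mathcal M)$ over the alphabet $\delta$ has as rules those of all admissible $T$ for which $A,B_1,\dots,B_m$ have sort at most $k$; its initial nonterminals are $\langle q_{\mathrm i},q;@,@\rangle$, $q\in Q_{\mathrm f}$, and its nonterminals are these and all that occur in the rules. The grammar $G(\mathcal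 M)$ over $\Sigma$ is obtained by replacing each $\tau\in\delta$ in the rules of $G'(\mathcal M)$ by $[\![\tau]\!]\in\Sigma\cup\{\varepsilon\}$. **Proposition.** Let $k\geq 1$ and let $\mathcal M$ be a cycle-free, $k$-restricted TSA in stack normal form. Then $G'(\mathcal M)$ is a $k$-MCFG and $L(G'(\mathcal M))$ is exactly the set of valid runs of $\mathcal M$; $G(\mathcal M)$ is a $k$-MCFG with $L(G(\mathcal M))=\{[\![\theta]\!]\mid\theta\in L(G'(\mathcal M))\}$; and $L(\mathcal M)=L(G(\mathcal M))$. -/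

import Mathlib

/-! Tree stack automata, multiple context-free grammars, and the construction of a grammar from a
tree stack automaton. -/

namespace TreeStackAutomata

/-! ### Parallel multiple context-free grammars -/

section Grammars

universe u v w

/-- A rule `A → [u₁, …, uₛ](A₁, …, A_ℓ)`.  A letter of a component `uᵢ` is either a terminal
(`Sum.inl`) or a variable (`Sum.inr`).  Variables are numbered from `0`: the variable `x_i^j`
(with `i, j ≥ 1`) is `Sum.inr (i - 1, j - 1)`. -/
structure Rule (N : Type u) (T : Type v) where
  lhs : N
  comps : List (List (T ⊕ ℕ × ℕ))
  rhs : List N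

/-- The value of a string of terminals and variables when `x_i^j` is replaced by the `j`-th component
of the `i`-th tuple.  (The default value is never used in a well-formed rule.) -/
def substitute {T : Type v} (ws : List (List (List T))) (u : List (T ⊕ ℕ × ℕ)) : List T :=
  u.flatMap fun x => match x with
    | Sum.inl t => [t]
    | Sum.inr (i, j) => ((ws[i]?).getD [])[j]?.getD []

/-- The components of a grammar `(N, T, I, R)`; that these form a (P)MCFG is expressed by
`Grammar.IsPMCFG` and `Grammar.IsMCFG`. -/
structure Grammar (N : Type u) (T : Type v) where
  sort : N → ℕ
  nonterminals : Set N
  initial : Set N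
  rules : Set (Rule N T)

namespace Grammar

variable {N : Type u} {T : Type v} {T' : Type w}

/-- `G` is a parallel multiple context-free grammar: the terminal alphabet, the sorted set of
nonterminals and the set of rules are finite, initial nonterminals have sort `1`, and all rules are
well-sorted. -/
structure IsPMCFG (G : Grammar N T) : Prop where
  finite_terminals : Finite T
  finite_nonterminals : G.nonterminals.Finite
  sort_pos : ∀ A ∈ G.nonterminals, 0 < G.sort A
  initial_subset : G.initial ⊆ G.nonterminals
  sort_initial : ∀ A ∈ G.initial, G.sort A = 1
  finite_rules : G.rules.Finite
  lhs_mem : ∀ r ∈ G.rules, r.lhs ∈ G.nonterminals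
  rhs_mem : ∀ r ∈ G.rules, ∀ B ∈ r.rhs, B ∈ G.nonterminals
  length_comps : ∀ r ∈ G.rules, r.comps.length = G.sort r.lhs
  variables_mem : ∀ r ∈ G.rules, ∀ u ∈ r.comps, ∀ i j : ℕ, Sum.inr (i, j) ∈ u →
    ∃ B, r.rhs[i]? = some B ∧ j < G.sort B

/-- `G` is a `k`-MCFG: a PMCFG in which every rule is linear (each variable occurs at most once in
`u₁ ⋯ uₛ`) and has fan-out at most `k`. -/
structure IsMCFG (G : Grammar N T) (k : ℕ) : Prop extends G.IsPMCFG where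
  linear : ∀ r ∈ G.rules, (r.comps.flatten.filterMap Sum.getRight?).Nodup
  fanout_le : ∀ r ∈ G.rules, r.comps.length ≤ k

/-- Derivations in `G` from a nonterminal. -/
inductive Deriv (G : Grammar N T) : N → Type (max u v)
  | node (r : Rule N T) (hr : r ∈ G.rules)
      (ds : (i : Fin r.rhs.length) → Deriv G (r.rhs.get i)) : Deriv G r.lhs

/-- The tuple of strings generated by a derivation. -/
def Deriv.tuple {G : Grammar N T} : {A : N} → G.Deriv A → List (List T)
  | _, .node r _ ds => r.comps.map (substitute (List.ofFn fun i => (ds i).tuple))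

/-- The language of `G`: strings (i.e. 1-tuples) generated by derivations from initial
nonterminals. -/
def language (G : Grammar N T) : Language T :=
  {w | ∃ S ∈ G.initial, ∃ d : G.Deriv S, d.tuple = [w]}

/-- The grammar obtained from `G` by replacing every terminal `t` in every rule by the string `h t`. -/
def mapTerminals (h : T → List T') (G : Grammar N T) : Grammar N T' where
  sort := G.sort
  nonterminals := G.nonterminals
  initial := G.initial
  rules := (fun r => ⟨r.lhs, r.comps.map fun u => u.flatMap fun x => match x with
    | Sum.inl t => (h t).map Sum.inl
    | Sum.inr y => [Sum.inr y], r.rhs⟩) '' G.rules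

end Grammar

end Grammars

/-! ### Tree stacks -/

section TreeStacks

universe u

/-- The set `Γ ∪ {@}`, where `bot` is the symbol `@ ∉ Γ`. -/
inductive Sym (Γ : Type u)
  | bot
  | sym (γ : Γ)

/-- Tree stacks over `Γ`: a partial function with finite prefix-closed domain that maps the root, and
only the root, to `@`, together with a pointer into its domain.  Positions are strings of positive
numbers with the last letter first: the `n`-th child `ρn` of `ρ` is `n :: ρ`. -/
structure TreeStack (Γ : Type u) where
  label : List ℕ+ → Option (Sym Γ)
  ptr : List ℕ+
  label_root : label [] = some Sym.bot
  label_ne_bot : ∀ ρ, ρ ≠ [] → label ρ ≠ some Sym.bot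
  finite_dom : {ρ | label ρ ≠ none}.Finite
  prefix_closed : ∀ n ρ, label (n :: ρ) ≠ none → label ρ ≠ none
  ptr_mem : label ptr ≠ none

/-- The initial tree stack, consisting of the root only. -/
def TreeStack.start (Γ : Type u) : TreeStack Γ where
  label ρ := if ρ = [] then some Sym.bot else none
  ptr := []
  label_root := by simp
  label_ne_bot := by intro ρ h; simp [h]
  finite_dom := (Set.finite_singleton ([] : List ℕ+)).subset (by intro ρ; simp)
  prefix_closed := by intro n ρ h; simp at h
  ptr_mem := by simp

/-- The predicates `bottom`, `equals(γ)` and the full predicate `TS(Γ)`. -/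
inductive Predicate (Γ : Type u)
  | bottom
  | equals (γ : Γ)
  | all

/-- Membership of a tree stack in a predicate. -/
def Predicate.Holds {Γ : Type u} : Predicate Γ → TreeStack Γ → Prop
  | .bottom, c => c.ptr = []
  | .equals γ, c => c.label c.ptr = some (.sym γ)
  | .all, _ => True

/-- `γ ∈ p` for a symbol `γ`: tree stacks with symbol `γ` at the pointer belong to `p`. -/
def Predicate.HasSym {Γ : Type u} : Predicate Γ → Sym Γ → Prop
  | .bottom, g => g = .bot
  | .equals γ, g => g = .sym γ
  | .all, _ => True

theorem Predicate.holds_iff_hasSym {Γ : Type u} (p : Predicate Γ) (c : TreeStack Γ) (g : Sym Γ)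
    (h : c.label c.ptr = some g) : p.Holds c ↔ p.HasSym g := by
  cases p with
  | bottom =>
    constructor
    · intro h0
      have h1 : c.ptr = [] := h0
      rw [h1, c.label_root] at h
      exact (Option.some.inj h).symm
    · intro h0
      have h1 : g = .bot := h0
      by_contra h2
      exact c.label_ne_bot c.ptr h2 (h1 ▸ h)
  | equals γ => simp [Predicate.Holds, Predicate.HasSym, h]
  | all => simp [Predicate.Holds, Predicate.HasSym]

/-- The instructions `id`, `push_n(γ)`, `up_n`, `down`, `set(γ)`. -/
inductive Instr (Γ : Type u)
  | ident
  | push (n : ℕ+) (γ : Γ)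
  | up (n : ℕ+)
  | down
  | write (γ : Γ)

namespace Instr

variable {Γ : Type u}

/-- The graph of the partial function on tree stacks denoted by an instruction. -/
def Rel : Instr Γ → TreeStack Γ → TreeStack Γ → Prop
  | .ident, c, c' => c' = c
  | .push n γ, c, c' => c.label (n :: c.ptr) = none ∧
      c'.label = Function.update c.label (n :: c.ptr) (some (.sym γ)) ∧ c'.ptr = n :: c.ptr
  | .up n, c, c' => c.label (n :: c.ptr) ≠ none ∧ c'.label = c.label ∧ c'.ptr = n :: c.ptr
  | .down, c, c' => c'.label = c.label ∧ ∃ n, c.ptr = n :: c'.ptr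
  | .write γ, c, c' => c.ptr ≠ [] ∧
      c'.label = Function.update c.label c.ptr (some (.sym γ)) ∧ c'.ptr = c.ptr

/-- The effect of an instruction on the stack pointer. -/
def move : Instr Γ → List ℕ+ → List ℕ+
  | .push n _, ρ => n :: ρ
  | .up n, ρ => n :: ρ
  | .down, ρ => ρ.tail
  | _, ρ => ρ

theorem Rel.ptr_eq {i : Instr Γ} {c c' : TreeStack Γ} (h : i.Rel c c') : c'.ptr = i.move c.ptr := by
  cases i with
  | ident => have h' : c' = c := h; rw [h']; rfl
  | push n γ => exact h.2.2
  | up n => exact h.2.2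
  | down => obtain ⟨n, hn⟩ := h.2; rw [hn]; rfl
  | write γ => exact h.2.2

/-- `i` is a `push`-instruction. -/
def IsPush (i : Instr Γ) : Prop := ∃ n γ, i = push n γ

/-- `i` is a `push`- or an `up`-instruction. -/
def isUpward : Instr Γ → Bool
  | .push _ _ => true
  | .up _ => true
  | _ => false

/-- `i` is an `id`- or a `set`-instruction. -/
def IsStay : Instr Γ → Prop
  | .ident => True
  | .write _ => True
  | _ => False

end Instr

end TreeStacks

/-! ### Tree stack automata -/

universe u v w

/-- A transition `(q, ω, p, f, q')` with `ω ∈ Σ ∪ {ε}` (`none` is `ε`). -/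
structure Transition (Q : Type u) (Γ : Type v) (α : Type w) where
  src : Q
  read : Option α
  pred : Predicate Γ
  instr : Instr Γ
  tgt : Q

/-- Tree stack automata with states `Q`, stack alphabet `Γ` and terminals `α`.  The initial storage
configuration is always `TreeStack.start Γ`. -/
structure TSA (Q : Type u) (Γ : Type v) (α : Type w) where
  start : Q
  trans : Finset (Transition Q Γ α)
  final : Set Q

namespace TSA

variable {Q : Type u} {Γ : Type v} {α : Type w}

/-- The alphabet `δ` of transitions of `M`. -/
abbrev Trans (M : TSA Q Γ α) : Type (max u v w) := {τ // τ ∈ M.trans}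

/-- `M.Run q c θ q' c'` means `(q, c) ⊢_θ (q', c')`. -/
inductive Run (M : TSA Q Γ α) : Q → TreeStack Γ → List M.Trans → Q → TreeStack Γ → Prop
  | nil (q : Q) (c : TreeStack Γ) : Run M q c [] q c
  | cons (τ : M.Trans) {c c' c'' : TreeStack Γ} {θ : List M.Trans} {q'' : Q} :
      τ.1.pred.Holds c → τ.1.instr.Rel c c' → Run M τ.1.tgt c' θ q'' c'' →
      Run M τ.1.src c (τ :: θ) q'' c''

/-- The string read by a transition. -/
def readWord (M : TSA Q Γ α) (τ : M.Trans) : List α := τ.1.read.toList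

/-- The string `⟦θ⟧` read by a run. -/
def word (M : TSA Q Γ α) (θ : List M.Trans) : List α := θ.flatMap M.readWord

/-- The valid runs of `M`. -/
def validRuns (M : TSA Q Γ α) : Language M.Trans :=
  {θ | ∃ q ∈ M.final, ∃ c, M.Run M.start (TreeStack.start Γ) θ q c}

/-- The language of `M`. -/
def language (M : TSA Q Γ α) : Language α := {w | ∃ θ ∈ M.validRuns, M.word θ = w}

/-- The number of times that position `ρ` is entered from below (by a `push`- or `up`-instruction)
in the run `θ` that starts with the stack pointer at `π`. -/
def entryCount (M : TSA Q Γ α) (ρ : List ℕ+) : List ℕ+ → List M.Trans → ℕ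
  | _, [] => 0
  | π, τ :: θ => (if τ.1.instr.isUpward ∧ τ.1.instr.move π = ρ then 1 else 0) +
      entryCount M ρ (τ.1.instr.move π) θ

/-- `M` is `k`-restricted: in valid runs, each position is entered from below at most `k` times. -/
def IsRestricted (M : TSA Q Γ α) (k : ℕ) : Prop :=
  ∀ θ ∈ M.validRuns, ∀ ρ, M.entryCount ρ [] θ ≤ k

/-- Runs from `q` to `q'` that use only `id`- and `set`-instructions and change the symbol at the
stack pointer from `g` to `g'`. -/
def stayRuns (M : TSA Q Γ α) (q q' : Q) (g g' : Sym Γ) : Set (List M.Trans) :=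
  {θ | (∀ τ ∈ θ, τ.1.instr.IsStay) ∧ ∃ c c' : TreeStack Γ, c.ptr = c'.ptr ∧
    c.label c.ptr = some g ∧ c'.label c'.ptr = some g' ∧ M.Run q c θ q' c'}

/-- `M` is cycle-free. -/
def IsCycleFree (M : TSA Q Γ α) : Prop := ∀ q g, M.stayRuns q q g g = {[]}

/-- `M` is in stack normal form: the stack pointer is at the root whenever `M` reaches a final
state. -/
def InStackNormalForm (M : TSA Q Γ α) : Prop :=
  ∀ θ q c, M.Run M.start (TreeStack.start Γ) θ q c → q ∈ M.final → c.ptr = []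

/-! ### From tree stack automata to grammars -/

/-- `Ω↑(q, q'; g, g'; j, β)`: a stay run that ends with symbol `g'`, then `push_j(β)` or `up_j`. -/
def upRuns (M : TSA Q Γ α) (q q' : Q) (g g' : Sym Γ) (j : ℕ+) (β : Γ) : Set (List M.Trans) :=
  {θ | ∃ σ τ, θ = σ ++ [τ] ∧ σ ∈ M.stayRuns q τ.1.src g g' ∧ τ.1.tgt = q' ∧
    τ.1.pred.HasSym g' ∧ (τ.1.instr = .push j β ∨ τ.1.instr = .up j)}

/-- `Ω↓(q, q'; g, g'; β')`: a `down` from a position with symbol `β'`, then a stay run. -/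
def downRuns (M : TSA Q Γ α) (q q' : Q) (g g' : Sym Γ) (β' : Γ) : Set (List M.Trans) :=
  {θ | ∃ τ σ, θ = τ :: σ ∧ τ.1.src = q ∧ τ.1.pred.HasSym (.sym β') ∧ τ.1.instr = .down ∧
    σ ∈ M.stayRuns τ.1.tgt q' g g'}

/-- `Ω↓↑(q, q'; g, g'; β', j, β)`: a `down` from a position with symbol `β'`, then a run in
`Ω↑`. -/
def downUpRuns (M : TSA Q Γ α) (q q' : Q) (g g' : Sym Γ) (β' : Γ) (j : ℕ+) (β : Γ) :
    Set (List M.Trans) :=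
  {θ | ∃ τ σ, θ = τ :: σ ∧ τ.1.src = q ∧ τ.1.pred.HasSym (.sym β') ∧ τ.1.instr = .down ∧
    σ ∈ M.upRuns τ.1.tgt q' g g' j β}

end TSA

/-- A `(q, q'; j, β, β')`-gap: the place of a run that starts at the `j`-th child of the current
position in state `q` with symbol `β` there, and ends at this child in state `q'` with symbol `β'`. -/
structure Gap (Q : Type u) (Γ : Type v) where
  q : Q
  q' : Q
  child : ℕ+
  β : Γ
  β' : Γ

/-- The nonterminal `⟨q₁, q₁', …, qₛ, qₛ'; γ₀, …, γₛ⟩`. -/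
structure Nonterminal (Q : Type u) (Γ : Type v) where
  states : List (Q × Q)
  syms : List (Sym Γ)

namespace TSA

variable {Q : Type u} {Γ : Type v} {α : Type w}

/-- `M.TailType e g θs es q₂ g₂`: the runs `θs = (θ₁, …, θ_ℓ)` can follow the gap `e` when the symbol
at the parent position is `g`; the further gaps are `es`, and the last run ends in state `q₂` with
symbol `g₂` at the parent position. -/
inductive TailType (M : TSA Q Γ α) :
    Gap Q Γ → Sym Γ → List (List M.Trans) → List (Gap Q Γ) → Q → Sym Γ → Prop
  | last {e : Gap Q Γ} {g : Sym Γ} {θ : List M.Trans} {q₂ : Q} {g₂ : Sym Γ} :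
      θ ∈ M.downRuns e.q' q₂ g g₂ e.β' → TailType M e g [θ] [] q₂ g₂
  | more {e e' : Gap Q Γ} {g g' : Sym Γ} {θ : List M.Trans} {θs : List (List M.Trans)}
      {es : List (Gap Q Γ)} {q₂ : Q} {g₂ : Sym Γ} :
      θ ∈ M.downUpRuns e.q' e'.q g g' e.β' e'.child e'.β → TailType M e' g' θs es q₂ g₂ →
      TailType M e g (θ :: θs) (e' :: es) q₂ g₂

/-- `M.TupleType θs es q₁ q₂ g₁ g₂`: the tuple of runs `θs = (θ₀, …, θ_ℓ)` is admissible with gaps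
`es` (one between any two neighbouring runs) and has type `⟨q₁, q₂; g₁, g₂⟩`. -/
inductive TupleType (M : TSA Q Γ α) :
    List (List M.Trans) → List (Gap Q Γ) → Q → Q → Sym Γ → Sym Γ → Prop
  | stay {θ : List M.Trans} {q₁ q₂ : Q} {g₁ g₂ : Sym Γ} :
      θ ∈ M.stayRuns q₁ q₂ g₁ g₂ → TupleType M [θ] [] q₁ q₂ g₁ g₂
  | gaps {e : Gap Q Γ} {θ : List M.Trans} {θs : List (List M.Trans)} {es : List (Gap Q Γ)}
      {q₁ q₂ : Q} {g₁ g g₂ : Sym Γ} :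
      θ ∈ M.upRuns q₁ e.q g₁ g e.child e.β → TailType M e g θs es q₂ g₂ →
      TupleType M (θ :: θs) (e :: es) q₁ q₂ g₁ g₂

/-- A tuple `t = (θ₀, …, θ_ℓ)` of runs together with a choice of its `ℓ` gaps. -/
structure GapTuple (M : TSA Q Γ α) where
  runs : List (List M.Trans)
  gaps : List (Gap Q Γ)

/-- `M.SeqType T qs g gs`: for `T = (t₁, …, tₛ)`, `qs = ((q₁, q₁'), …, (qₛ, qₛ'))`, `g = γ₀` and
`gs = (γ₁, …, γₛ)`, each `tᵢ` is admissible and has type `⟨qᵢ, qᵢ'; γᵢ₋₁, γᵢ⟩`. -/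
inductive SeqType (M : TSA Q Γ α) :
    List M.GapTuple → List (Q × Q) → Sym Γ → List (Sym Γ) → Prop
  | nil (g : Sym Γ) : SeqType M [] [] g []
  | cons {t : M.GapTuple} {T : List M.GapTuple} {q q' : Q} {qs : List (Q × Q)} {g g' : Sym Γ}
      {gs : List (Sym Γ)} :
      M.TupleType t.runs t.gaps q q' g g' → SeqType M T qs g' gs →
      SeqType M (t :: T) ((q, q') :: qs) g (g' :: gs)

/-- All gaps of `T`, read left-to-right. -/
def allGaps (M : TSA Q Γ α) (T : List M.GapTuple) : List (Gap Q Γ) := T.flatMap fun t => t.gaps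

/-- The gaps of `T` at the `j`-th child, read left-to-right. -/
def gapsAt (M : TSA Q Γ α) (T : List M.GapTuple) (j : ℕ+) : List (Gap Q Γ) :=
  (M.allGaps T).filter fun e => e.child = j

/-- The distinct children at which `T` has gaps, in the order of their first occurrences. -/
def children (M : TSA Q Γ α) (T : List M.GapTuple) : List ℕ+ :=
  ((M.allGaps T).map fun e => e.child).reverse.dedup.reverse

/-- All runs of `T` that are followed by a gap, each with this gap, read left-to-right. -/
def openings (M : TSA Q Γ α) (T : List M.GapTuple) : List (List M.Trans × Gap Q Γ) :=
  T.flatMap fun t => t.runs.zip t.gaps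

/-- The last transition of `θ` has a `push`-instruction. -/
def EndsWithPush (M : TSA Q Γ α) (θ : List M.Trans) : Prop :=
  ∃ τ ∈ θ.getLast?, τ.1.instr.IsPush

/-- The conditions on the behaviour of `T` at the children: a run before a gap ends with a `push` if
and only if this gap is the first one at its child, and the symbols of consecutive gaps at the same
child fit together. -/
def ChildrenMatch (M : TSA Q Γ α) (T : List M.GapTuple) : Prop :=
  (∀ l₁ θ e l₂, M.openings T = l₁ ++ (θ, e) :: l₂ →
    (M.EndsWithPush θ ↔ ∀ x ∈ l₁, x.2.child ≠ e.child)) ∧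
  ∀ j, (M.gapsAt T j).IsChain fun e e' => e.β' = e'.β

/-- The nonterminal for the sequence `es` of gaps at one child. -/
def gapNonterminal (es : List (Gap Q Γ)) : Nonterminal Q Γ where
  states := es.map fun e => (e.q, e.q')
  syms := match es with
    | [] => []
    | e :: _ => Sym.sym e.β :: es.map fun e' => Sym.sym e'.β'

/-- `θ₀ y₁ θ₁ ⋯ y_ℓ θ_ℓ` for runs `θ₀, …, θ_ℓ` and variables `y₁, …, y_ℓ`. -/
def weave (M : TSA Q Γ α) : List (List M.Trans) → List (ℕ × ℕ) → List (M.Trans ⊕ ℕ × ℕ)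
  | [], _ => []
  | θ :: θs, [] => θ.map Sum.inl ++ weave M θs []
  | θ :: θs, y :: ys => θ.map Sum.inl ++ Sum.inr y :: weave M θs ys

/-- The variables for a list of gaps, where `D` lists the distinct children and `seen` the children of
the gaps further to the left.  A gap at child `j` gets the variable whose lower index is the position
of `j` in `D` and whose upper index is the number of earlier gaps at `j` (counting from `0`). -/
def gapVars (D : List ℕ+) : List ℕ+ → List (Gap Q Γ) → List (ℕ × ℕ)
  | _, [] => []
  | seen, e :: es => (D.idxOf e.child, seen.count e.child) :: gapVars D (seen ++ [e.child]) es

/-- The components `u₁, …, uₛ` of the rule for `(t₁, …, tₛ)`, with `D` and `seen` as in `gapVars`. -/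
def ruleComps (M : TSA Q Γ α) (D : List ℕ+) :
    List ℕ+ → List M.GapTuple → List (List (M.Trans ⊕ ℕ × ℕ))
  | _, [] => []
  | seen, t :: T => M.weave t.runs (gapVars D seen t.gaps) ::
      ruleComps M D (seen ++ t.gaps.map fun e => e.child) T

/-- The initial nonterminals `⟨q_i, q; @, @⟩` with `q` final. -/
def runInitial (M : TSA Q Γ α) : Set (Nonterminal Q Γ) :=
  {A | ∃ q ∈ M.final, A = ⟨[(M.start, q)], [Sym.bot, Sym.bot]⟩}

/-- The rules of the run grammar: one for every nonempty admissible `T = (t₁, …, tₛ)` of type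
`(A; B₁, …, B_m)` such that `A, B₁, …, B_m` have sort at most `k`. -/
def runRules (M : TSA Q Γ α) (k : ℕ) : Set (Rule (Nonterminal Q Γ) M.Trans) :=
  {r | ∃ T qs g gs, T ≠ [] ∧ T.length ≤ k ∧ (∀ j, (M.gapsAt T j).length ≤ k) ∧
    M.SeqType T qs g gs ∧ M.ChildrenMatch T ∧
    r = { lhs := ⟨qs, g :: gs⟩
          comps := M.ruleComps (M.children T) [] T
          rhs := (M.children T).map fun j => gapNonterminal (M.gapsAt T j) }}

/-- The grammar `G'(M)` over the alphabet of transitions. -/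
def runGrammar (M : TSA Q Γ α) (k : ℕ) : Grammar (Nonterminal Q Γ) M.Trans where
  sort A := A.states.length
  nonterminals := M.runInitial ∪ {A | ∃ r ∈ M.runRules k, A = r.lhs ∨ A ∈ r.rhs}
  initial := M.runInitial
  rules := M.runRules k

/-- The grammar `G(M)`: the image of `G'(M)` under the homomorphism `θ ↦ ⟦θ⟧`. -/
def wordGrammar (M : TSA Q Γ α) (k : ℕ) : Grammar (Nonterminal Q Γ) α :=
  (M.runGrammar k).mapTerminals M.readWord

end TSA

end TreeStackAutomata

namespace TreeStackAutomata

universe u v w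

namespace Grammar

variable {N : Type u} {T : Type v} {T' : Type w}

theorem Deriv.tuple_node {G : Grammar N T} (r : Rule N T) (hr : r ∈ G.rules)
    (ds : (i : Fin r.rhs.length) → Deriv G (r.rhs.get i)) :
    (Deriv.node r hr ds).tuple = r.comps.map (substitute (List.ofFn fun i => (ds i).tuple)) := by
  simp [Deriv.tuple]

/-- `G.Generates A ws`: the tuple `ws` of words is generated from the nonterminal `A`. -/
def Generates (G : Grammar N T) (A : N) (ws : List (List T)) : Prop :=
  ∃ d : G.Deriv A, d.tuple = ws

theorem Generates.of_rule {G : Grammar N T} {r : Rule N T} (hr : r ∈ G.rules)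
    (W : Fin r.rhs.length → List (List T)) (h : ∀ i, G.Generates (r.rhs.get i) (W i)) :
    G.Generates r.lhs (r.comps.map (substitute (List.ofFn W))) := by
  choose ds hds using h
  exact ⟨.node r hr ds, by rw [Deriv.tuple_node]; simp only [hds]⟩

theorem Generates.induction {G : Grammar N T} {P : N → List (List T) → Prop}
    (step : ∀ r ∈ G.rules, ∀ W : Fin r.rhs.length → List (List T),
      (∀ i, G.Generates (r.rhs.get i) (W i) ∧ P (r.rhs.get i) (W i)) →
      P r.lhs (r.comps.map (substitute (List.ofFn W))))
    {A : N} {ws : List (List T)} (h : G.Generates A ws) : P A ws := by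
  obtain ⟨d, rfl⟩ := h
  induction d with
  | node r hr ds ih =>
    rw [Deriv.tuple_node]
    exact step r hr _ fun i => ⟨⟨ds i, rfl⟩, ih i⟩

theorem mem_language {G : Grammar N T} {w : List T} :
    w ∈ G.language ↔ ∃ S ∈ G.initial, G.Generates S [w] := Iff.rfl

/-- The image of a string of terminals and variables under a homomorphism on the terminals. -/
def mapString (h : T → List T') (u : List (T ⊕ ℕ × ℕ)) : List (T' ⊕ ℕ × ℕ) :=
  u.flatMap fun x => match x with
    | Sum.inl t => (h t).map Sum.inl
    | Sum.inr y => [Sum.inr y]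

theorem mem_rules_mapTerminals {h : T → List T'} {G : Grammar N T} {r : Rule N T'} :
    r ∈ (G.mapTerminals h).rules ↔
      ∃ r₀ ∈ G.rules, r = ⟨r₀.lhs, r₀.comps.map (mapString h), r₀.rhs⟩ := by
  constructor
  · rintro ⟨r₀, h₀, rfl⟩; exact ⟨r₀, h₀, rfl⟩
  · rintro ⟨r₀, h₀, rfl⟩; exact ⟨r₀, h₀, rfl⟩

theorem substitute_map (h : T → List T') (ws : List (List (List T))) (u : List (T ⊕ ℕ × ℕ)) :
    substitute (ws.map fun W => W.map fun w => w.flatMap h) (mapString h u) =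
      (substitute ws u).flatMap h := by
  induction u with
  | nil => rfl
  | cons x u ih =>
    unfold substitute mapString at *
    rcases x with t | ⟨i, j⟩
    · simp only [List.flatMap_cons, List.flatMap_append, ih, List.flatMap_map]
      simp
    · simp only [List.flatMap_cons, List.flatMap_append, ih, List.singleton_append]
      congr 1
      rw [List.getElem?_map]
      rcases ws[i]? with _ | W
      · simp
      · simp only [Option.map_some, Option.getD_some, List.getElem?_map]
        rcases W[j]? with _ | w <;> simp

theorem generates_mapTerminals {h : T → List T'} {G : Grammar N T} {A : N} {ws : List (List T')} :
    (G.mapTerminals h).Generates A ws ↔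
      ∃ vs, G.Generates A vs ∧ ws = vs.map fun w => w.flatMap h := by
  constructor
  · intro hA
    refine Generates.induction
      (P := fun A ws => ∃ vs, G.Generates A vs ∧ ws = vs.map fun w => w.flatMap h) ?_ hA
    intro r hr W hW
    obtain ⟨r₀, h₀, rfl⟩ := mem_rules_mapTerminals.1 hr
    choose V hV hVW using fun i => (hW i).2
    refine ⟨_, Generates.of_rule h₀ V hV, ?_⟩
    have : List.ofFn W = (List.ofFn V).map fun W => W.map fun w => w.flatMap h := by
      rw [List.map_ofFn]; congr 1; funext i; exact hVW i
    rw [this, List.map_map, List.map_map]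
    exact List.map_congr_left fun u _ => substitute_map h _ u
  · rintro ⟨vs, hA, rfl⟩
    refine Generates.induction (G := G)
      (P := fun A vs => (G.mapTerminals h).Generates A (vs.map fun w => w.flatMap h)) ?_ hA
    intro r hr W hW
    have := Generates.of_rule (G := G.mapTerminals h)
      (mem_rules_mapTerminals.2 ⟨r, hr, rfl⟩) (fun i => (W i).map fun w => w.flatMap h)
      fun i => (hW i).2
    convert this using 1
    have e : (List.ofFn fun i => (W i).map fun w => w.flatMap h) =
        (List.ofFn W).map fun W => W.map fun w => w.flatMap h := by
      rw [List.map_ofFn]; rfl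
    rw [e, List.map_map, List.map_map]
    exact List.map_congr_left fun u _ => (substitute_map h _ u).symm

theorem language_mapTerminals (h : T → List T') (G : Grammar N T) :
    (G.mapTerminals h).language = {w | ∃ v ∈ G.language, v.flatMap h = w} := by
  ext w
  constructor
  · rintro ⟨S, hS, hd⟩
    obtain ⟨vs, hvs, e⟩ := generates_mapTerminals.1 hd
    obtain ⟨v, rfl, hv⟩ := List.map_eq_singleton_iff.1 e.symm
    exact ⟨v, ⟨S, hS, hvs⟩, hv⟩
  · rintro ⟨v, ⟨S, hS, hd⟩, rfl⟩
    exact ⟨S, hS, generates_mapTerminals.2 ⟨[v], hd, rfl⟩⟩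

theorem filterMap_getRight_mapString (h : T → List T') (u : List (T ⊕ ℕ × ℕ)) :
    (mapString h u).filterMap Sum.getRight? = u.filterMap Sum.getRight? := by
  induction u with
  | nil => rfl
  | cons x u ih =>
    unfold mapString at *
    rcases x with t | y
    · have h0 : (h t).filterMap (Sum.getRight? ∘ Sum.inl (β := ℕ × ℕ)) = [] := by
        simp [List.filterMap_eq_nil_iff]
      rw [List.flatMap_cons, List.filterMap_append, ih, List.filterMap_map, h0,
        List.filterMap_cons_none rfl, List.nil_append]
    · simp [ih]

theorem IsMCFG.mapTerminals [Finite T'] {G : Grammar N T} {k : ℕ} (hG : G.IsMCFG k)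
    (h : T → List T') : (G.mapTerminals h).IsMCFG k where
  finite_terminals := inferInstance
  finite_nonterminals := hG.finite_nonterminals
  sort_pos := hG.sort_pos
  initial_subset := hG.initial_subset
  sort_initial := hG.sort_initial
  finite_rules := hG.finite_rules.image _
  lhs_mem := by
    intro r hr
    obtain ⟨r₀, h₀, rfl⟩ := mem_rules_mapTerminals.1 hr
    exact hG.lhs_mem r₀ h₀
  rhs_mem := by
    intro r hr
    obtain ⟨r₀, h₀, rfl⟩ := mem_rules_mapTerminals.1 hr
    exact hG.rhs_mem r₀ h₀
  length_comps := by
    intro r hr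
    obtain ⟨r₀, h₀, rfl⟩ := mem_rules_mapTerminals.1 hr
    rw [List.length_map]
    exact hG.length_comps r₀ h₀
  variables_mem := by
    intro r hr u hu i j hij
    obtain ⟨r₀, h₀, rfl⟩ := mem_rules_mapTerminals.1 hr
    obtain ⟨u₀, hu₀, rfl⟩ := List.mem_map.1 hu
    refine hG.variables_mem r₀ h₀ u₀ hu₀ i j ?_
    have h1 : (i, j) ∈ (mapString h u₀).filterMap Sum.getRight? :=
      List.mem_filterMap.2 ⟨_, hij, rfl⟩
    rw [filterMap_getRight_mapString] at h1
    obtain ⟨x, hx, hxy⟩ := List.mem_filterMap.1 h1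
    rw [Sum.getRight?_eq_some_iff] at hxy
    exact hxy ▸ hx
  linear := by
    intro r hr
    obtain ⟨r₀, h₀, rfl⟩ := mem_rules_mapTerminals.1 hr
    have h1 := hG.linear r₀ h₀
    rw [List.filterMap_flatten] at h1 ⊢
    simpa [Function.comp_def, filterMap_getRight_mapString] using h1
  fanout_le := by
    intro r hr
    obtain ⟨r₀, h₀, rfl⟩ := mem_rules_mapTerminals.1 hr
    simpa using hG.fanout_le r₀ h₀

end Grammar

variable {Q : Type u} {Γ : Type v} {α : Type w}

/-! ### Tree stacks and instructions -/

theorem TreeStack.exists_label (c : TreeStack Γ) : ∃ g, c.label c.ptr = some g :=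
  Option.ne_none_iff_exists'.1 c.ptr_mem

theorem TreeStack.label_append_ne_none (c : TreeStack Γ) (π ρ : List ℕ+)
    (h : c.label (π ++ ρ) ≠ none) : c.label ρ ≠ none := by
  induction π with
  | nil => exact h
  | cons n π ih => exact ih (c.prefix_closed n _ h)

theorem TreeStack.exists_push (c : TreeStack Γ) (n : ℕ+) (γ : Γ)
    (h : c.label (n :: c.ptr) = none) : ∃ c', (Instr.push n γ).Rel c c' := by
  refine ⟨⟨Function.update c.label (n :: c.ptr) (some (.sym γ)), n :: c.ptr, ?_, ?_, ?_, ?_, ?_⟩,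
    h, rfl, rfl⟩
  · rw [Function.update_of_ne (by simp)]; exact c.label_root
  · intro ρ hρ
    by_cases e : ρ = n :: c.ptr
    · rw [e, Function.update_self]; simp
    · rw [Function.update_of_ne e]; exact c.label_ne_bot ρ hρ
  · refine (c.finite_dom.insert (n :: c.ptr)).subset ?_
    intro ρ hρ
    by_cases e : ρ = n :: c.ptr
    · exact Or.inl e
    · refine Or.inr ?_
      have h1 : Function.update c.label (n :: c.ptr) (some (.sym γ)) ρ ≠ none := hρ
      rw [Function.update_of_ne e] at h1
      exact h1
  · intro m ρ hρ
    by_cases e' : ρ = n :: c.ptr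
    · rw [e', Function.update_self]; simp
    rw [Function.update_of_ne e']
    by_cases e : m :: ρ = n :: c.ptr
    · obtain ⟨-, rfl⟩ := List.cons.inj e
      exact c.ptr_mem
    · rw [Function.update_of_ne e] at hρ
      exact c.prefix_closed m ρ hρ
  · rw [Function.update_self]; simp

theorem TreeStack.exists_write (c : TreeStack Γ) (γ : Γ) (h : c.ptr ≠ []) :
    ∃ c', (Instr.write γ).Rel c c' := by
  have key : ∀ ρ, Function.update c.label c.ptr (some (.sym γ)) ρ ≠ none ↔ c.label ρ ≠ none := by
    intro ρ
    by_cases e : ρ = c.ptr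
    · rw [e, Function.update_self]; simp [c.ptr_mem]
    · rw [Function.update_of_ne e]
  refine ⟨⟨Function.update c.label c.ptr (some (.sym γ)), c.ptr, ?_, ?_, ?_, ?_, ?_⟩, h, rfl, rfl⟩
  · rw [Function.update_of_ne h.symm]; exact c.label_root
  · intro ρ hρ
    by_cases e : ρ = c.ptr
    · rw [e, Function.update_self]; simp
    · rw [Function.update_of_ne e]; exact c.label_ne_bot ρ hρ
  · simp only [key]; exact c.finite_dom
  · intro m ρ hρ
    rw [key] at hρ ⊢
    exact c.prefix_closed m ρ hρ
  · rw [key]; exact c.ptr_mem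

theorem TreeStack.exists_up (c : TreeStack Γ) (n : ℕ+) (h : c.label (n :: c.ptr) ≠ none) :
    ∃ c', (Instr.up n).Rel c c' :=
  ⟨⟨c.label, n :: c.ptr, c.label_root, c.label_ne_bot, c.finite_dom, c.prefix_closed, h⟩,
    h, rfl, rfl⟩

theorem TreeStack.exists_down (c : TreeStack Γ) (n : ℕ+) (ρ : List ℕ+) (h : c.ptr = n :: ρ) :
    ∃ c', Instr.down.Rel c c' ∧ c'.ptr = ρ :=
  ⟨⟨c.label, ρ, c.label_root, c.label_ne_bot, c.finite_dom, c.prefix_closed,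
    c.prefix_closed n ρ (h ▸ c.ptr_mem)⟩, ⟨rfl, n, h⟩, rfl⟩

theorem TreeStack.exists_sym (g : Sym Γ) : ∃ c : TreeStack Γ, c.label c.ptr = some g := by
  cases g with
  | bot => exact ⟨TreeStack.start Γ, (TreeStack.start Γ).label_root⟩
  | sym γ =>
    obtain ⟨c, -, hl, hp⟩ := (TreeStack.start Γ).exists_push 1 γ (by simp [TreeStack.start])
    exact ⟨c, by rw [hl, hp, Function.update_self]⟩

/-- The child to which an instruction leads (arbitrary unless it is a `push` or an `up`). -/
def Instr.childIndex : Instr Γ → ℕ+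
  | .push n _ => n
  | .up n => n
  | _ => 1

/-- The effect of an `id`- or `set`-instruction on the symbol at the stack pointer. -/
def Instr.StayRel (i : Instr Γ) (g g' : Sym Γ) : Prop :=
  (i = .ident ∧ g' = g) ∨ ∃ γ₀ γ, i = .write γ ∧ g = .sym γ₀ ∧ g' = .sym γ

theorem Instr.StayRel.isStay {i : Instr Γ} {g g' : Sym Γ} (h : i.StayRel g g') : i.IsStay := by
  rcases h with ⟨rfl, -⟩ | ⟨_, γ, rfl, -⟩ <;> trivial

theorem Instr.StayRel.move_eq {i : Instr Γ} {g g' : Sym Γ} (h : i.StayRel g g') (ρ : List ℕ+) :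
    i.move ρ = ρ := by
  rcases h with ⟨rfl, -⟩ | ⟨_, γ, rfl, -⟩ <;> rfl

theorem Instr.StayRel.isUpward {i : Instr Γ} {g g' : Sym Γ} (h : i.StayRel g g') :
    i.isUpward = false := by
  rcases h with ⟨rfl, -⟩ | ⟨_, γ, rfl, -⟩ <;> rfl

theorem Instr.StayRel.not_isPush {i : Instr Γ} {g g' : Sym Γ} (h : i.StayRel g g') :
    ¬ i.IsPush := by
  rintro ⟨n, γ, rfl⟩
  exact h.isStay

theorem Instr.StayRel.exists_rel {i : Instr Γ} {g g' : Sym Γ} (h : i.StayRel g g')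
    (c : TreeStack Γ) (hc : c.label c.ptr = some g) :
    ∃ c', i.Rel c c' ∧ c'.ptr = c.ptr ∧ c'.label = Function.update c.label c.ptr (some g') := by
  rcases h with ⟨rfl, rfl⟩ | ⟨γ₀, γ, rfl, rfl, rfl⟩
  · exact ⟨c, rfl, rfl, by rw [← hc, Function.update_eq_self]⟩
  · obtain ⟨c', h'⟩ := c.exists_write γ (by
      intro h0
      rw [h0, c.label_root] at hc
      simp at hc)
    exact ⟨c', h', h'.2.2, h'.2.1⟩

theorem Instr.Rel.stayRel {i : Instr Γ} {c c' : TreeStack Γ} (h : i.Rel c c') (hi : i.IsStay)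
    {g : Sym Γ} (hg : c.label c.ptr = some g) :
    ∃ g', i.StayRel g g' ∧ c'.ptr = c.ptr ∧
      c'.label = Function.update c.label c.ptr (some g') := by
  cases i with
  | ident =>
    have h' : c' = c := h
    exact ⟨g, Or.inl ⟨rfl, rfl⟩, by rw [h'], by rw [h', ← hg, Function.update_eq_self]⟩
  | write γ =>
    obtain ⟨h0, hl, hp⟩ := h
    refine ⟨.sym γ, Or.inr ?_, hp, hl⟩
    cases g with
    | bot => exact absurd hg (c.label_ne_bot _ h0)
    | sym γ₀ => exact ⟨γ₀, γ, rfl, rfl, rfl⟩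
  | push n γ => exact hi.elim
  | up n => exact hi.elim
  | down => exact hi.elim

namespace TSA

/-! ### Runs that stay at a position -/

/-- The runs in `M.stayRuns`, in terms of symbols only. -/
inductive StayRun (M : TSA Q Γ α) : Q → Sym Γ → List M.Trans → Q → Sym Γ → Prop
  | nil (q : Q) (g : Sym Γ) : StayRun M q g [] q g
  | cons (τ : M.Trans) {g g₁ g' : Sym Γ} {θ : List M.Trans} {q' : Q} :
      τ.1.pred.HasSym g → τ.1.instr.StayRel g g₁ → StayRun M τ.1.tgt g₁ θ q' g' →
      StayRun M τ.1.src g (τ :: θ) q' g'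

theorem mem_stayRuns_iff {M : TSA Q Γ α} {q q' : Q} {g g' : Sym Γ} {θ : List M.Trans} :
    θ ∈ M.stayRuns q q' g g' ↔ M.StayRun q g θ q' g' := by
  constructor
  · rintro ⟨hstay, c, c', -, hc, hc', hrun⟩
    induction hrun generalizing g with
    | nil q c =>
      rw [hc] at hc'
      rw [Option.some.inj hc']
      exact .nil q g'
    | cons τ hp hi _ ih =>
      obtain ⟨g₁, hg₁, e, hl⟩ := hi.stayRel (hstay τ (by simp)) hc
      refine .cons τ ((Predicate.holds_iff_hasSym _ _ _ hc).1 hp) hg₁ ?_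
      exact ih (fun τ' h => hstay τ' (by simp [h])) (by rw [e, hl, Function.update_self]) hc'
  · intro h
    suffices H : ∀ c : TreeStack Γ, c.label c.ptr = some g → ∃ c' : TreeStack Γ,
        c.ptr = c'.ptr ∧ c'.label c'.ptr = some g' ∧ M.Run q c θ q' c' by
      obtain ⟨c, hc⟩ := TreeStack.exists_sym g
      obtain ⟨c', h1, h2, h3⟩ := H c hc
      refine ⟨?_, c, c', h1, hc, h2, h3⟩
      clear H h3 h2 h1 hc
      induction h with
      | nil => simp
      | cons τ _ hi _ ih =>
        intro τ' hτ'
        rcases List.mem_cons.1 hτ' with rfl | hτ'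
        · exact hi.isStay
        · exact ih τ' hτ'
    induction h with
    | nil q g => exact fun c hc => ⟨c, rfl, hc, .nil q c⟩
    | cons τ hp hi _ ih =>
      intro c hc
      obtain ⟨c₁, hr, e, hl⟩ := hi.exists_rel c hc
      obtain ⟨c', h1, h2, h3⟩ := ih c₁ (by rw [e, hl, Function.update_self])
      exact ⟨c', by rw [← h1, e], h2, .cons τ ((Predicate.holds_iff_hasSym _ _ _ hc).2 hp) hr h3⟩

/-- In a cycle-free automaton, the configurations in a stay run are pairwise distinct. -/
theorem StayRun.exists_nodup {M : TSA Q Γ α} (hM : M.IsCycleFree) {q q' : Q} {g g' : Sym Γ}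
    {θ : List M.Trans} (h : M.StayRun q g θ q' g') :
    ∃ l : List (Q × Sym Γ), l.length = θ.length + 1 ∧ l.Nodup ∧
      ∀ x ∈ l, ∃ σ, M.StayRun q g σ x.1 x.2 := by
  induction h with
  | nil q g => exact ⟨[(q, g)], rfl, by simp, by simpa using ⟨[], .nil q g⟩⟩
  | @cons τ g g₁ g' θ q' hp hi _ ih =>
    obtain ⟨l, hl, hnd, hx⟩ := ih
    refine ⟨(τ.1.src, g) :: l, by simp [hl], List.nodup_cons.2 ⟨?_, hnd⟩, ?_⟩
    · intro hmem
      obtain ⟨σ, hσ⟩ := hx _ hmem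
      have h1 := mem_stayRuns_iff.2 (StayRun.cons τ hp hi hσ)
      rw [hM] at h1
      simp at h1
    · intro x hxm
      rcases List.mem_cons.1 hxm with rfl | hxm
      · exact ⟨[], .nil _ _⟩
      · obtain ⟨σ, hσ⟩ := hx x hxm
        exact ⟨_, .cons τ hp hi hσ⟩

instance [Finite Γ] : Finite (Sym Γ) :=
  Finite.of_surjective (fun o : Option Γ => o.elim Sym.bot Sym.sym) fun g => by
    cases g with
    | bot => exact ⟨none, rfl⟩
    | sym γ => exact ⟨some γ, rfl⟩

theorem StayRun.length_lt [Finite Q] [Finite Γ] {M : TSA Q Γ α} (hM : M.IsCycleFree) {q q' : Q}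
    {g g' : Sym Γ} {θ : List M.Trans} (h : M.StayRun q g θ q' g') :
    θ.length < Nat.card (Q × Sym Γ) := by
  obtain ⟨l, hl, hnd, -⟩ := h.exists_nodup hM
  have := Fintype.ofFinite (Q × Sym Γ)
  rw [Nat.card_eq_fintype_card]
  have h1 := hnd.length_le_card
  omega

/-! ### Admissible tuples -/

/-- The tuples in `M.TupleType`, built up from right to left. -/
inductive Admissible (M : TSA Q Γ α) :
    List (List M.Trans) → List (Gap Q Γ) → Q → Q → Sym Γ → Sym Γ → Prop
  | stay {θ : List M.Trans} {q₁ q₂ : Q} {g₁ g₂ : Sym Γ} :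
      M.StayRun q₁ g₁ θ q₂ g₂ → Admissible M [θ] [] q₁ q₂ g₁ g₂
  | gap {e : Gap Q Γ} {σ θ : List M.Trans} {τ τ' : M.Trans} {θs : List (List M.Trans)}
      {es : List (Gap Q Γ)} {q₁ q₂ : Q} {g₁ g g₂ : Sym Γ} :
      M.StayRun q₁ g₁ σ τ.1.src g → τ.1.pred.HasSym g →
      (τ.1.instr = .push e.child e.β ∨ τ.1.instr = .up e.child) → τ.1.tgt = e.q →
      τ'.1.src = e.q' → τ'.1.pred.HasSym (.sym e.β') → τ'.1.instr = .down →
      Admissible M (θ :: θs) es τ'.1.tgt q₂ g g₂ →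
      Admissible M ((σ ++ [τ]) :: (τ' :: θ) :: θs) (e :: es) q₁ q₂ g₁ g₂

theorem TailType.exists_tupleType {M : TSA Q Γ α} {e : Gap Q Γ} {g g₂ : Sym Γ} {q₂ : Q}
    {θs : List (List M.Trans)} {es : List (Gap Q Γ)} (h : M.TailType e g θs es q₂ g₂) :
    ∃ (τ : M.Trans) (θ : List M.Trans) (θs' : List (List M.Trans)), θs = (τ :: θ) :: θs' ∧
      τ.1.src = e.q' ∧ τ.1.pred.HasSym (.sym e.β') ∧ τ.1.instr = .down ∧
      M.TupleType (θ :: θs') es τ.1.tgt q₂ g g₂ := by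
  cases h with
  | last h =>
    obtain ⟨τ, σ, rfl, h1, h2, h3, h4⟩ := h
    exact ⟨τ, σ, [], rfl, h1, h2, h3, .stay h4⟩
  | more h ht =>
    obtain ⟨τ, σ, rfl, h1, h2, h3, h4⟩ := h
    exact ⟨τ, σ, _, rfl, h1, h2, h3, .gaps h4 ht⟩

theorem tupleType_iff_admissible {M : TSA Q Γ α} {θs : List (List M.Trans)}
    {es : List (Gap Q Γ)} {q₁ q₂ : Q} {g₁ g₂ : Sym Γ} :
    M.TupleType θs es q₁ q₂ g₁ g₂ ↔ M.Admissible θs es q₁ q₂ g₁ g₂ := by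
  constructor
  · intro h
    induction es generalizing θs q₁ g₁ with
    | nil =>
      cases h with
      | stay h => exact .stay (mem_stayRuns_iff.1 h)
    | cons e es ih =>
      cases h with
      | gaps h ht =>
        obtain ⟨τ', θ, θs', rfl, h1, h2, h3, h4⟩ := ht.exists_tupleType
        obtain ⟨σ, τ, rfl, k1, k2, k3, k4⟩ := h
        exact .gap (mem_stayRuns_iff.1 k1) k3 k4 k2 h1 h2 h3 (ih h4)
  · intro h
    induction h with
    | stay h => exact .stay (mem_stayRuns_iff.2 h)
    | gap k1 k3 k4 k2 h1 h2 h3 _ ih =>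
      refine .gaps ⟨_, _, rfl, mem_stayRuns_iff.2 k1, k2, k3, k4⟩ ?_
      cases ih with
      | stay h => exact .last ⟨_, _, rfl, h1, h2, h3, h⟩
      | gaps h ht => exact .more ⟨_, _, rfl, h1, h2, h3, h⟩ ht

theorem Admissible.length_runs {M : TSA Q Γ α} {θs : List (List M.Trans)}
    {es : List (Gap Q Γ)} {q₁ q₂ : Q} {g₁ g₂ : Sym Γ} (h : M.Admissible θs es q₁ q₂ g₁ g₂) :
    θs.length = es.length + 1 := by
  induction h with
  | stay => rfl
  | gap _ _ _ _ _ _ _ _ ih => simp only [List.length_cons] at ih ⊢; omega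

theorem Admissible.cons_stay {M : TSA Q Γ α} {τ : M.Trans} {θ : List M.Trans}
    {θs : List (List M.Trans)} {es : List (Gap Q Γ)} {q₂ : Q} {g g₁ g₂ : Sym Γ}
    (hp : τ.1.pred.HasSym g) (hi : τ.1.instr.StayRel g g₁)
    (h : M.Admissible (θ :: θs) es τ.1.tgt q₂ g₁ g₂) :
    M.Admissible ((τ :: θ) :: θs) es τ.1.src q₂ g g₂ := by
  cases h with
  | stay h => exact .stay (.cons τ hp hi h)
  | gap k1 k2 k3 k4 h1 h2 h3 h => exact .gap (σ := τ :: _) (.cons τ hp hi k1) k2 k3 k4 h1 h2 h3 h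

end TSA

theorem Instr.isStay_or_isUpward_or_down (i : Instr Γ) :
    i.IsStay ∨ i.isUpward = true ∨ i = .down := by
  cases i <;> simp [Instr.IsStay, Instr.isUpward]

/-! ### Subtrees of tree stacks -/

/-- The labelling of the positions below some position of a tree stack, or of no positions at all. -/
abbrev Subtree (Γ : Type v) := List ℕ+ → Option (Sym Γ)

namespace Subtree

/-- The subtree without positions. -/
def empty : Subtree Γ := fun _ => none

/-- The subtree that consists of its root only. -/
def single (g : Sym Γ) : Subtree Γ := fun π => if π = [] then some g else none

/-- The subtree at the `j`-th child of the root. -/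
def child (s : Subtree Γ) (j : ℕ+) : Subtree Γ := fun π => s (π ++ [j])

/-- Replace the subtree at the `j`-th child of the root. -/
def graft (s : Subtree Γ) (j : ℕ+) (a : Subtree Γ) : Subtree Γ :=
  fun π => if π.getLast? = some j then a π.dropLast else s π

@[simp] theorem single_nil (g : Sym Γ) : single g [] = some g := rfl

@[simp] theorem child_single (g : Sym Γ) (j : ℕ+) : (single g).child j = empty := by
  funext π; simp [child, single, empty]

@[simp] theorem graft_nil (s : Subtree Γ) (j : ℕ+) (a : Subtree Γ) : s.graft j a [] = s [] := by
  simp [graft]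

@[simp] theorem child_graft_self (s : Subtree Γ) (j : ℕ+) (a : Subtree Γ) :
    (s.graft j a).child j = a := by
  funext π; simp [child, graft]

theorem child_graft_of_ne (s : Subtree Γ) {i j : ℕ+} (h : i ≠ j) (a : Subtree Γ) :
    (s.graft j a).child i = s.child i := by
  funext π; simp [child, graft, h]

theorem child_update (s : Subtree Γ) (j : ℕ+) (o : Option (Sym Γ)) :
    child (Function.update s [] o) j = s.child j := by
  funext π; simp [child]

/-- The subtree `a` of a position turns into `b` when the position is entered by the instruction `i`
(which is `push_j(β)` or `up_j`) and then has symbol `β`. -/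
def Enter (i : Instr Γ) (j : ℕ+) (β : Γ) (a b : Subtree Γ) : Prop :=
  (i = .push j β ∧ a = empty ∧ b = single (.sym β)) ∨
    (i = .up j ∧ a [] = some (.sym β) ∧ b = a)

theorem Enter.move_eq {i : Instr Γ} {j : ℕ+} {β : Γ} {a b : Subtree Γ} (h : Enter i j β a b)
    (ρ : List ℕ+) : i.move ρ = j :: ρ := by
  rcases h with ⟨rfl, -⟩ | ⟨rfl, -⟩ <;> rfl

theorem Enter.isUpward {i : Instr Γ} {j : ℕ+} {β : Γ} {a b : Subtree Γ} (h : Enter i j β a b) :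
    i.isUpward = true := by
  rcases h with ⟨rfl, -⟩ | ⟨rfl, -⟩ <;> rfl

end Subtree

namespace TreeStack

/-- The subtree at the stack pointer. -/
def subtree (c : TreeStack Γ) : Subtree Γ := fun π => c.label (π ++ c.ptr)

theorem subtree_nil (c : TreeStack Γ) : c.subtree [] = c.label c.ptr := rfl

theorem subtree_start : (TreeStack.start Γ).subtree = Subtree.single .bot := by
  funext π; simp [subtree, start, Subtree.single]

theorem subtree_update {c c' : TreeStack Γ} {o : Option (Sym Γ)} (hp : c'.ptr = c.ptr)
    (hl : c'.label = Function.update c.label c.ptr o) :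
    c'.subtree = Function.update c.subtree [] o := by
  funext π
  by_cases h : π = []
  · subst h; simp [subtree, hp, hl]
  · rw [Function.update_of_ne h]
    simp only [subtree, hp, hl]
    rw [Function.update_of_ne (by simpa using h)]

theorem enter_of_rel {i : Instr Γ} {c c' : TreeStack Γ} (h : i.Rel c c')
    (hi : i.isUpward = true) :
    ∃ j β, c'.ptr = j :: c.ptr ∧ Subtree.Enter i j β (c.subtree.child j) c'.subtree ∧
      ∀ ρ, ρ ≠ j :: c.ptr → c'.label ρ = c.label ρ := by
  cases i with
  | ident => simp [Instr.isUpward] at hi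
  | down => simp [Instr.isUpward] at hi
  | write => simp [Instr.isUpward] at hi
  | push n γ =>
    obtain ⟨hn, hl, hp⟩ := h
    refine ⟨n, γ, hp, Or.inl ⟨rfl, ?_, ?_⟩, fun ρ hρ => by rw [hl, Function.update_of_ne hρ]⟩
    · funext π
      by_contra h0
      refine c.label_append_ne_none π (n :: c.ptr) ?_ hn
      simpa [Subtree.child, subtree, Subtree.empty] using h0
    · funext π
      by_cases h : π = []
      · subst h; simp [subtree, hp, hl]
      · simp only [subtree, hp, hl, Subtree.single, if_neg h]
        rw [Function.update_of_ne (by simpa using h)]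
        by_contra h0
        exact c.label_append_ne_none π (n :: c.ptr) h0 hn
  | up n =>
    obtain ⟨hn, hl, hp⟩ := h
    obtain ⟨g, hg⟩ := Option.ne_none_iff_exists'.1 hn
    cases g with
    | bot => exact absurd hg (c.label_ne_bot _ (by simp))
    | sym β =>
      refine ⟨n, β, hp, Or.inr ⟨rfl, by simpa [Subtree.child, subtree] using hg, ?_⟩,
        fun ρ _ => by rw [hl]⟩
      funext π
      simp [Subtree.child, subtree, hl, hp]

theorem exists_rel_of_enter {i : Instr Γ} {c : TreeStack Γ} {j : ℕ+} {β : Γ} {b : Subtree Γ}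
    (h : Subtree.Enter i j β (c.subtree.child j) b) :
    ∃ c', i.Rel c c' ∧ c'.ptr = j :: c.ptr ∧ c'.subtree = b ∧
      ∀ ρ, ρ ≠ j :: c.ptr → c'.label ρ = c.label ρ := by
  rcases h with ⟨rfl, ha, rfl⟩ | ⟨rfl, ha, rfl⟩
  · obtain ⟨c', h'⟩ := c.exists_push j β (by
      simpa [Subtree.child, subtree, Subtree.empty] using congrFun ha [])
    refine ⟨c', h', h'.2.2, ?_, fun ρ hρ => by rw [h'.2.1, Function.update_of_ne hρ]⟩
    funext π
    by_cases h : π = []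
    · subst h; simp [subtree, h'.2.1, h'.2.2]
    · simp only [subtree, h'.2.1, h'.2.2, Subtree.single, if_neg h]
      rw [Function.update_of_ne (by simpa using h)]
      simpa [Subtree.child, subtree, Subtree.empty] using congrFun ha π
  · obtain ⟨c', h'⟩ := c.exists_up j (by
      have : c.label (j :: c.ptr) = some (.sym β) := by simpa [Subtree.child, subtree] using ha
      simp [this])
    refine ⟨c', h', h'.2.2, ?_, fun ρ _ => by rw [h'.2.1]⟩
    funext π
    simp [Subtree.child, subtree, h'.2.1, h'.2.2]

/-- The subtree at the parent after the subtree at the `j`-th child has been changed. -/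
theorem subtree_eq_graft {c c₁ c₂ : TreeStack Γ} {j : ℕ+} (h₁ : c₁.ptr = j :: c.ptr)
    (h₂ : c₂.ptr = c.ptr) (hl : c₂.label = c₁.label)
    (h : ∀ ρ, ¬ (j :: c.ptr) <:+ ρ → c₁.label ρ = c.label ρ) :
    c₂.subtree = c.subtree.graft j c₁.subtree := by
  funext π
  rcases List.eq_nil_or_concat π with rfl | ⟨π, i, rfl⟩
  · simp only [Subtree.graft_nil, subtree, hl, h₂]
    exact h _ fun h0 => by simpa using h0.length_le
  · by_cases e : i = j
    · subst e
      simp [subtree, Subtree.graft, hl, h₂, h₁]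
    · simp only [subtree, Subtree.graft, hl, h₂, List.concat_eq_append, List.getLast?_append,
        List.getLast?_singleton, Option.some_or, Option.some.injEq, e, if_false]
      refine h _ ?_
      rintro ⟨σ, hσ⟩
      have h1 := congrArg (List.take σ.length) hσ
      have h2 := congrArg List.length hσ
      simp only [List.append_assoc, List.length_append, List.length_cons, List.length_nil] at h2
      have h3 : σ ++ [j] ++ c.ptr = π ++ [i] ++ c.ptr := by simpa using hσ
      have h4 := List.append_cancel_right h3
      exact e (by simpa using (congrArg List.getLast? h4).symm)

end TreeStack

namespace TSA

/-! ### Visits of a position -/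

/-- `M.Visit q s θ q' s'`: the run `θ` starts and ends at the same position, does not leave the
subtree at this position, and changes this subtree from `s` to `s'`. -/
inductive Visit (M : TSA Q Γ α) : Q → Subtree Γ → List M.Trans → Q → Subtree Γ → Prop
  | nil (q : Q) (s : Subtree Γ) : Visit M q s [] q s
  | stay (τ : M.Trans) {s s' : Subtree Γ} {g g₁ : Sym Γ} {θ : List M.Trans} {q' : Q} :
      s [] = some g → τ.1.pred.HasSym g → τ.1.instr.StayRel g g₁ →
      Visit M τ.1.tgt (Function.update s [] (some g₁)) θ q' s' → Visit M τ.1.src s (τ :: θ) q' s'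
  | excursion (τ τ' : M.Trans) {s s' a a' : Subtree Γ} {g : Sym Γ} {j : ℕ+} {β β' : Γ}
      {w θ : List M.Trans} {q' : Q} :
      s [] = some g → τ.1.pred.HasSym g → Subtree.Enter τ.1.instr j β (s.child j) a →
      Visit M τ.1.tgt a w τ'.1.src a' → a' [] = some (.sym β') → τ'.1.pred.HasSym (.sym β') →
      τ'.1.instr = .down → Visit M τ'.1.tgt (s.graft j a') θ q' s' →
      Visit M τ.1.src s (τ :: (w ++ τ' :: θ)) q' s'

theorem Run.append {M : TSA Q Γ α} {q q' q'' : Q} {c c' c'' : TreeStack Γ} {θ θ' : List M.Trans}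
    (h : M.Run q c θ q' c') (h' : M.Run q' c' θ' q'' c'') : M.Run q c (θ ++ θ') q'' c'' := by
  induction h with
  | nil => exact h'
  | cons τ hp hi _ ih => exact .cons τ hp hi (ih h')

theorem Visit.exists_run {M : TSA Q Γ α} {q q' : Q} {s s' : Subtree Γ} {θ : List M.Trans}
    (h : M.Visit q s θ q' s') (c : TreeStack Γ) (hc : c.subtree = s) :
    ∃ c', M.Run q c θ q' c' ∧ c'.ptr = c.ptr ∧ c'.subtree = s' ∧
      ∀ ρ, ¬ c.ptr <:+ ρ → c'.label ρ = c.label ρ := by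
  induction h generalizing c with
  | nil q s => exact ⟨c, .nil q c, rfl, hc, fun _ _ => rfl⟩
  | stay τ hs hp hi _ ih =>
    subst hc
    obtain ⟨c₁, hr, e, hl⟩ := hi.exists_rel c hs
    obtain ⟨c', h1, h2, h3, h4⟩ := ih c₁ (TreeStack.subtree_update e hl)
    refine ⟨c', .cons τ ((Predicate.holds_iff_hasSym _ _ _ hs).2 hp) hr h1, h2.trans e, h3, ?_⟩
    intro ρ hρ
    rw [h4 ρ (e ▸ hρ), hl, Function.update_of_ne]
    rintro rfl
    exact hρ (List.suffix_refl _)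
  | @excursion τ τ' s s' a a' g j β β' w θ q' hs hp he _ ha' hp' hd _ ih ih' =>
    subst hc
    obtain ⟨c₁, hr₁, e₁, hs₁, hl₁⟩ := TreeStack.exists_rel_of_enter he
    obtain ⟨c₂, hr₂, e₂, hs₂, hl₂⟩ := ih c₁ hs₁
    rw [e₁] at e₂
    obtain ⟨c₃, hr₃, e₃⟩ := c₂.exists_down j c.ptr e₂
    have hg : c₃.subtree = c.subtree.graft j c₂.subtree := by
      refine TreeStack.subtree_eq_graft e₂ e₃ hr₃.1 fun ρ hρ => ?_
      rw [hl₂ ρ (e₁ ▸ hρ), hl₁ ρ]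
      rintro rfl
      exact hρ (List.suffix_refl _)
    obtain ⟨c₄, hr₄, e₄, hs₄, hl₄⟩ := ih' c₃ (by rw [hg, hs₂])
    refine ⟨c₄, .cons τ ((Predicate.holds_iff_hasSym _ _ _ hs).2 hp) hr₁ (hr₂.append
      (.cons τ' ((Predicate.holds_iff_hasSym _ _ _ ?_).2 hp') (hd ▸ hr₃) hr₄)),
      e₄.trans e₃, hs₄, ?_⟩
    · rw [← c₂.subtree_nil, hs₂, ha']
    · intro ρ hρ
      have h1 : ¬ (j :: c.ptr) <:+ ρ := fun h1 => hρ ((List.suffix_cons j c.ptr).trans h1)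
      rw [hl₄ ρ (e₃ ▸ hρ), hr₃.1, hl₂ ρ (e₁ ▸ h1), hl₁ ρ]
      rintro rfl
      exact h1 (List.suffix_refl _)

/-- A run that ends at the root first visits the subtree at its starting position; then it has ended,
or it goes down to the parent position. -/
theorem Run.exists_visit {M : TSA Q Γ α} (n : ℕ) {q q' : Q} {c c' : TreeStack Γ}
    {θ : List M.Trans} (hn : θ.length ≤ n) (h : M.Run q c θ q' c') (hc' : c'.ptr = []) :
    (c.ptr = [] ∧ M.Visit q c.subtree θ q' c'.subtree) ∨
    ∃ (j : ℕ+) (ρ : List ℕ+) (w : List M.Trans) (τ : M.Trans) (θ' : List M.Trans)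
      (c₁ c₂ : TreeStack Γ) (β : Γ), c.ptr = j :: ρ ∧ θ = w ++ τ :: θ' ∧
      M.Visit q c.subtree w τ.1.src c₁.subtree ∧ c₁.ptr = c.ptr ∧
      (∀ π, ¬ c.ptr <:+ π → c₁.label π = c.label π) ∧
      c₁.subtree [] = some (.sym β) ∧ τ.1.pred.HasSym (.sym β) ∧ τ.1.instr = .down ∧
      c₂.label = c₁.label ∧ c₂.ptr = ρ ∧ M.Run τ.1.tgt c₂ θ' q' c' := by
  induction n generalizing q c θ with
  | zero =>
    obtain rfl : θ = [] := List.eq_nil_of_length_eq_zero (by omega)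
    cases h with
    | nil => exact Or.inl ⟨hc', .nil _ _⟩
  | succ n ih =>
  cases h with
  | nil => exact Or.inl ⟨hc', .nil _ _⟩
  | @cons τ _ c₁ _ θ _ hp hi hr =>
  obtain ⟨g, hg⟩ := c.exists_label
  have hpg := (Predicate.holds_iff_hasSym _ _ _ hg).1 hp
  simp only [List.length_cons] at hn
  rcases τ.1.instr.isStay_or_isUpward_or_down with hst | hup | hτ
  · obtain ⟨g₁, hg₁, e, hl⟩ := hi.stayRel hst hg
    have hsub := TreeStack.subtree_update e hl
    rcases ih (by omega) hr with ⟨h1, h2⟩ | ⟨j, ρ, w, τ', θ', d₁, d₂, β, h1, rfl, h2, h3, h4, h5⟩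
    · exact Or.inl ⟨e ▸ h1, .stay τ hg hpg hg₁ (hsub ▸ h2)⟩
    · refine Or.inr ⟨j, ρ, τ :: w, τ', θ', d₁, d₂, β, e ▸ h1, rfl,
        .stay τ hg hpg hg₁ (hsub ▸ h2), h3.trans e, fun π hπ => ?_, h5⟩
      rw [h4 π (e ▸ hπ), hl, Function.update_of_ne]
      rintro rfl
      exact hπ (List.suffix_refl _)
  · obtain ⟨j, β, e, he, hl⟩ := TreeStack.enter_of_rel hi hup
    rcases ih (by omega) hr with ⟨h1, h2⟩ |
      ⟨j', ρ, w, τ', θ', d₁, d₂, β', h1, rfl, h2, h3, h4, h5, h6, h7, h8, h9, h10⟩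
    · rw [e] at h1; cases h1
    · rw [e] at h1
      obtain ⟨rfl, rfl⟩ := List.cons.inj h1
      have hrest : ∀ ρ, ¬ (j :: c.ptr) <:+ ρ → d₁.label ρ = c.label ρ := by
        intro ρ hρ
        rw [h4 ρ (e ▸ hρ), hl]
        rintro rfl
        exact hρ (List.suffix_refl _)
      have hgr : d₂.subtree = c.subtree.graft j d₁.subtree :=
        TreeStack.subtree_eq_graft (h3.trans e) h9 h8 hrest
      simp only [List.length_append, List.length_cons] at hn
      rcases ih (by omega) h10 with ⟨k1, k2⟩ |
        ⟨i, ρ, w', τ'', θ'', d₃, d₄, β'', k1, rfl, k2, k3, k4, k5⟩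
      · exact Or.inl ⟨h9 ▸ k1, .excursion τ τ' hg hpg he h2 h5 h6 h7 (hgr ▸ k2)⟩
      · refine Or.inr ⟨i, ρ, τ :: (w ++ τ' :: w'), τ'', θ'', d₃, d₄, β'', h9 ▸ k1, by simp,
          .excursion τ τ' hg hpg he h2 h5 h6 h7 (hgr ▸ k2), k3.trans h9, fun π hπ => ?_, k5⟩
        rw [k4 π (h9 ▸ hπ), h8, hrest π]
        exact fun h1 => hπ ((List.suffix_cons j c.ptr).trans h1)
  · rw [hτ] at hi
    obtain ⟨hl, j, hj⟩ := hi
    cases g with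
    | bot => exact absurd hg (c.label_ne_bot _ (by simp [hj]))
    | sym β =>
      exact Or.inr ⟨j, c₁.ptr, [], τ, θ, c, c₁, β, hj, rfl, .nil _ _, rfl, fun _ _ => rfl, hg, hpg,
        hτ, hl, rfl, hr⟩

theorem mem_validRuns_iff {M : TSA Q Γ α} (hM : M.InStackNormalForm) {θ : List M.Trans} :
    θ ∈ M.validRuns ↔ ∃ q ∈ M.final, ∃ s, s [] = some .bot ∧
      M.Visit M.start (Subtree.single .bot) θ q s := by
  constructor
  · rintro ⟨q, hq, c, hr⟩
    have hc := hM θ q c hr hq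
    rcases hr.exists_visit _ le_rfl hc with ⟨-, h⟩ | ⟨j, ρ, w, τ, θ', c₁, c₂, β, h, -⟩
    · refine ⟨q, hq, c.subtree, ?_, TreeStack.subtree_start (Γ := Γ) ▸ h⟩
      rw [c.subtree_nil, hc, c.label_root]
    · cases h
  · rintro ⟨q, hq, s, -, h⟩
    obtain ⟨c, hr, -⟩ := h.exists_run _ TreeStack.subtree_start
    exact ⟨q, hq, c, hr⟩

/-! ### Counting entries -/

theorem entryCount_stay {M : TSA Q Γ α} {τ : M.Trans} {g g' : Sym Γ}
    (h : τ.1.instr.StayRel g g') (ρ π : List ℕ+) (θ : List M.Trans) :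
    M.entryCount ρ π (τ :: θ) = M.entryCount ρ π θ := by
  rw [entryCount, h.move_eq, h.isUpward]; simp

theorem entryCount_enter {M : TSA Q Γ α} {τ : M.Trans} {j : ℕ+} {β : Γ} {a b : Subtree Γ}
    (h : Subtree.Enter τ.1.instr j β a b) (ρ π : List ℕ+) (θ : List M.Trans) :
    M.entryCount ρ π (τ :: θ) = (if j :: π = ρ then 1 else 0) + M.entryCount ρ (j :: π) θ := by
  rw [entryCount, h.move_eq, h.isUpward]; simp

theorem entryCount_down {M : TSA Q Γ α} {τ : M.Trans} (h : τ.1.instr = .down) (j : ℕ+)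
    (ρ π : List ℕ+) (θ : List M.Trans) :
    M.entryCount ρ (j :: π) (τ :: θ) = M.entryCount ρ π θ := by
  rw [entryCount, h]; simp [Instr.isUpward, Instr.move]

theorem Visit.entryCount_append {M : TSA Q Γ α} {q q' : Q} {s s' : Subtree Γ} {θ : List M.Trans}
    (h : M.Visit q s θ q' s') (ρ π : List ℕ+) (θ' : List M.Trans) :
    M.entryCount ρ π (θ ++ θ') = M.entryCount ρ π θ + M.entryCount ρ π θ' := by
  induction h generalizing π θ' with
  | nil => simp [entryCount]
  | stay τ _ _ hi _ ih => rw [List.cons_append, entryCount_stay hi, entryCount_stay hi, ih]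
  | excursion τ τ' _ _ he _ _ _ hd _ ih ih' =>
    rw [List.cons_append, List.append_assoc, List.cons_append, entryCount_enter he, ih,
      entryCount_down hd, ih', entryCount_enter he, ih, entryCount_down hd]
    omega

theorem Visit.entryCount_shift {M : TSA Q Γ α} {q q' : Q} {s s' : Subtree Γ} {θ : List M.Trans}
    (h : M.Visit q s θ q' s') (ρ π σ : List ℕ+) :
    M.entryCount (ρ ++ σ) (π ++ σ) θ = M.entryCount ρ π θ := by
  induction h generalizing π with
  | nil => rfl
  | stay τ _ _ hi _ ih => rw [entryCount_stay hi, entryCount_stay hi, ih]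
  | excursion τ τ' _ _ he h1 _ _ hd _ ih ih' =>
    rw [entryCount_enter he, entryCount_enter he, h1.entryCount_append, h1.entryCount_append,
      entryCount_down hd, entryCount_down hd, ih', ← List.cons_append, ih]
    simp only [List.append_cancel_right_eq]

/-! ### Sequences of visits -/

/-- `M.VisitSeq s qs gs ws s'`: consecutive visits of a position along the runs `ws` change the
subtree at this position from `s` to `s'`; the `i`-th visit leads from the first to the second state
in the `i`-th pair in `qs`, and ends with the `i`-th symbol in `gs` at the position. -/
inductive VisitSeq (M : TSA Q Γ α) :
    Subtree Γ → List (Q × Q) → List (Sym Γ) → List (List M.Trans) → Subtree Γ → Prop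
  | nil (s : Subtree Γ) : VisitSeq M s [] [] [] s
  | cons {s s₁ s' : Subtree Γ} {q q' : Q} {w : List M.Trans} {g' : Sym Γ} {qs : List (Q × Q)}
      {gs : List (Sym Γ)} {ws : List (List M.Trans)} :
      M.Visit q s w q' s₁ → s₁ [] = some g' → VisitSeq M s₁ qs gs ws s' →
      VisitSeq M s ((q, q') :: qs) (g' :: gs) (w :: ws) s'

/-- `M.ChildRun a L a'`: filling the gaps in `L`, all of them at the same child, by the given runs
changes the subtree at this child from `a` to `a'`. -/
inductive ChildRun (M : TSA Q Γ α) :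
    Subtree Γ → List (Gap Q Γ × List M.Trans) → Subtree Γ → Prop
  | nil (a : Subtree Γ) : ChildRun M a [] a
  | cons {a b b' a' : Subtree Γ} {e : Gap Q Γ} {w : List M.Trans}
      {L : List (Gap Q Γ × List M.Trans)} :
      (a = Subtree.empty ∧ b = Subtree.single (.sym e.β)) ∨ (a [] = some (.sym e.β) ∧ b = a) →
      M.Visit e.q b w e.q' b' → b' [] = some (.sym e.β') → ChildRun M b' L a' →
      ChildRun M a ((e, w) :: L) a'

theorem ChildRun.append {M : TSA Q Γ α} {a b c : Subtree Γ}
    {L L' : List (Gap Q Γ × List M.Trans)} (h : M.ChildRun a L b) (h' : M.ChildRun b L' c) :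
    M.ChildRun a (L ++ L') c := by
  induction h with
  | nil => exact h'
  | cons h1 h2 h3 _ ih => exact .cons h1 h2 h3 (ih h')

theorem childRun_iff_of_root {M : TSA Q Γ α} {a a' : Subtree Γ} {β : Γ}
    {L : List (Gap Q Γ × List M.Trans)} (ha : a [] = some (.sym β)) :
    M.ChildRun a L a' ↔ (∀ e ∈ (L.map Prod.fst).head?, β = e.β) ∧
      (L.map Prod.fst).IsChain (fun e e' => e.β' = e'.β) ∧
      M.VisitSeq a ((L.map Prod.fst).map fun e => (e.q, e.q'))
        ((L.map Prod.fst).map fun e => Sym.sym e.β') (L.map Prod.snd) a' := by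
  induction L generalizing a β with
  | nil =>
    constructor
    · intro h
      cases h
      exact ⟨by simp, by simp, .nil _⟩
    · rintro ⟨-, -, h⟩
      cases h
      exact .nil _
  | cons x L ih =>
    obtain ⟨e, w⟩ := x
    constructor
    · intro h
      cases h with
      | cons h1 h2 h3 h4 =>
        rcases h1 with ⟨rfl, -⟩ | ⟨h1, rfl⟩
        · cases ha
        · obtain ⟨k1, k2, k3⟩ := (ih h3).1 h4
          rw [ha] at h1
          refine ⟨by simpa using h1, ?_, .cons h2 h3 k3⟩
          rw [List.map_cons, List.isChain_cons]
          exact ⟨k1, k2⟩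
    · rintro ⟨h1, h2, h3⟩
      rw [List.map_cons, List.isChain_cons] at h2
      cases h3 with
      | cons k1 k2 k3 =>
        obtain rfl : β = e.β := by simpa using h1
        exact .cons (Or.inr ⟨ha, rfl⟩) k1 k2 ((ih k2).2 ⟨h2.1, h2.2, k3⟩)

theorem childRun_empty_cons_iff {M : TSA Q Γ α} {a' : Subtree Γ} {e : Gap Q Γ}
    {w : List M.Trans} {L : List (Gap Q Γ × List M.Trans)} :
    M.ChildRun Subtree.empty ((e, w) :: L) a' ↔
      (((e, w) :: L).map Prod.fst).IsChain (fun e e' => e.β' = e'.β) ∧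
      M.VisitSeq (Subtree.single (.sym e.β)) ((((e, w) :: L).map Prod.fst).map fun e => (e.q, e.q'))
        ((((e, w) :: L).map Prod.fst).map fun e => Sym.sym e.β') (((e, w) :: L).map Prod.snd) a' := by
  have h : M.ChildRun Subtree.empty ((e, w) :: L) a' ↔
      M.ChildRun (Subtree.single (.sym e.β)) ((e, w) :: L) a' := by
    constructor
    · intro h
      cases h with
      | cons h1 h2 h3 h4 =>
        rcases h1 with ⟨-, rfl⟩ | ⟨h1, rfl⟩
        · exact .cons (Or.inr ⟨rfl, rfl⟩) h2 h3 h4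
        · cases h1
    · intro h
      cases h with
      | cons h1 h2 h3 h4 =>
        rcases h1 with ⟨h1, rfl⟩ | ⟨h1, rfl⟩
        · exact .cons (Or.inl ⟨rfl, rfl⟩) h2 h3 h4
        · exact .cons (Or.inl ⟨rfl, rfl⟩) h2 h3 h4
  rw [h, childRun_iff_of_root (Subtree.single_nil _)]
  simp

/-! ### Runs that end with a `push` -/

theorem endsWithPush_append_singleton {M : TSA Q Γ α} (σ : List M.Trans) (τ : M.Trans) :
    M.EndsWithPush (σ ++ [τ]) ↔ τ.1.instr.IsPush := by
  simp [EndsWithPush]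

theorem endsWithPush_cons {M : TSA Q Γ α} {τ : M.Trans} (hτ : ¬ τ.1.instr.IsPush)
    (θ : List M.Trans) : M.EndsWithPush (τ :: θ) ↔ M.EndsWithPush θ := by
  rcases List.eq_nil_or_concat θ with rfl | ⟨σ, τ', rfl⟩
  · simp [EndsWithPush, hτ]
  · rw [List.concat_eq_append, ← List.cons_append, endsWithPush_append_singleton,
      endsWithPush_append_singleton]

/-- A run before a gap ends with a `push` if and only if there is no earlier gap at the same child,
where `seen` lists the children of gaps further to the left. -/
def PushFirst (M : TSA Q Γ α) : List ℕ+ → List (List M.Trans × Gap Q Γ) → Prop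
  | _, [] => True
  | seen, x :: L => (M.EndsWithPush x.1 ↔ x.2.child ∉ seen) ∧ PushFirst M (seen ++ [x.2.child]) L

theorem pushFirst_append {M : TSA Q Γ α} (seen : List ℕ+) (L L' : List (List M.Trans × Gap Q Γ)) :
    M.PushFirst seen (L ++ L') ↔
      M.PushFirst seen L ∧ M.PushFirst (seen ++ L.map fun x => x.2.child) L' := by
  induction L generalizing seen with
  | nil => simp [PushFirst]
  | cons x L ih => simp [PushFirst, ih, and_assoc]

theorem pushFirst_iff {M : TSA Q Γ α} (seen : List ℕ+) (L : List (List M.Trans × Gap Q Γ)) :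
    M.PushFirst seen L ↔ ∀ l₁ θ e l₂, L = l₁ ++ (θ, e) :: l₂ →
      (M.EndsWithPush θ ↔ e.child ∉ seen ∧ ∀ x ∈ l₁, x.2.child ≠ e.child) := by
  constructor
  · rintro h l₁ θ e l₂ rfl
    have h1 := ((pushFirst_append _ _ _).1 h).2.1
    rw [h1, List.mem_append, not_or, List.mem_map]
    simp
  · intro h
    induction L generalizing seen with
    | nil => trivial
    | cons x L ih =>
      refine ⟨by simpa using h [] x.1 x.2 L rfl, ih _ ?_⟩
      rintro l₁ θ e l₂ rfl
      rw [h (x :: l₁) θ e l₂ rfl]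
      simp only [List.mem_append, List.mem_singleton, List.forall_mem_cons, not_or]
      tauto

theorem PushFirst.cons_run {M : TSA Q Γ α} {seen : List ℕ+} {τ : M.Trans}
    (hτ : ¬ τ.1.instr.IsPush) {θ : List M.Trans} {θs : List (List M.Trans)} {es : List (Gap Q Γ)} :
    M.PushFirst seen (((τ :: θ) :: θs).zip es) ↔ M.PushFirst seen ((θ :: θs).zip es) := by
  cases es with
  | nil => simp
  | cons e es => simp [PushFirst, endsWithPush_cons hτ]

/-! ### Visits and admissible tuples -/

/-- `θ₀ w₁ θ₁ ⋯ w_ℓ θ_ℓ` for lists of runs `θ₀, …, θ_ℓ` and `w₁, …, w_ℓ`. -/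
def interleave {T : Type w} : List (List T) → List (List T) → List T
  | [], _ => []
  | θ :: θs, [] => θ ++ interleave θs []
  | θ :: θs, w :: ws => θ ++ (w ++ interleave θs ws)

theorem interleave_cons_cons {T : Type w} (t : T) (θ : List T) (θs ws : List (List T)) :
    interleave ((t :: θ) :: θs) ws = t :: interleave (θ :: θs) ws := by
  cases ws <;> rfl

theorem StayRun.visit_append {M : TSA Q Γ α} {q q₁ q' : Q} {g g₁ : Sym Γ} {σ θ : List M.Trans}
    {s s' : Subtree Γ} (h : M.StayRun q g σ q₁ g₁) (hs : s [] = some g)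
    (hv : M.Visit q₁ (Function.update s [] (some g₁)) θ q' s') : M.Visit q s (σ ++ θ) q' s' := by
  induction h generalizing s with
  | nil q g => rwa [← hs, Function.update_eq_self] at hv
  | cons τ hp hi _ ih =>
    refine .stay τ hs hp hi (ih (by simp) ?_)
    rwa [Function.update_idem]

theorem forall_mem_seen_update {seen : List ℕ+} {s : Subtree Γ}
    (h : ∀ j, j ∈ seen ↔ s.child j [] ≠ none) (o : Option (Sym Γ)) (j : ℕ+) :
    j ∈ seen ↔ Subtree.child (Function.update s [] o) j [] ≠ none := by
  rw [Subtree.child_update]; exact h j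

theorem forall_mem_seen_graft {seen : List ℕ+} {s : Subtree Γ}
    (h : ∀ j, j ∈ seen ↔ s.child j [] ≠ none) (i : ℕ+) {a : Subtree Γ} (ha : a [] ≠ none) (j : ℕ+) :
    j ∈ seen ++ [i] ↔ (s.graft i a).child j [] ≠ none := by
  by_cases e : j = i
  · subst e; simp [ha]
  · rw [Subtree.child_graft_of_ne _ e, ← h j]; simp [e]

/-- The gaps in `L` at the `j`-th child, with the runs that fill them. -/
def fillsAt {T : Type w} (L : List (Gap Q Γ × T)) (j : ℕ+) : List (Gap Q Γ × T) :=
  L.filter fun x => x.1.child = j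

theorem fillsAt_append {T : Type w} (L L' : List (Gap Q Γ × T)) (j : ℕ+) :
    fillsAt (L ++ L') j = fillsAt L j ++ fillsAt L' j := List.filter_append ..

theorem fillsAt_cons_self {T : Type w} (e : Gap Q Γ) (t : T) (L : List (Gap Q Γ × T)) :
    fillsAt ((e, t) :: L) e.child = (e, t) :: fillsAt L e.child := by
  simp [fillsAt]

theorem fillsAt_cons_of_ne {T : Type w} {e : Gap Q Γ} {j : ℕ+} (h : j ≠ e.child) (t : T)
    (L : List (Gap Q Γ × T)) : fillsAt ((e, t) :: L) j = fillsAt L j := by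
  simp [fillsAt, h.symm]

theorem Admissible.exists_visit {M : TSA Q Γ α} {θs : List (List M.Trans)} {es : List (Gap Q Γ)}
    {q q' : Q} {g g' : Sym Γ} (h : M.Admissible θs es q q' g g') {s : Subtree Γ}
    (hs : s [] = some g) {seen : List ℕ+} (hseen : ∀ j, j ∈ seen ↔ s.child j [] ≠ none)
    (hpush : M.PushFirst seen (θs.zip es)) {L : List (Gap Q Γ × List M.Trans)}
    (hL : es = L.map Prod.fst) {R : ℕ+ → List (Gap Q Γ × List M.Trans)} {f : ℕ+ → Subtree Γ}
    (hf : ∀ j, M.ChildRun (s.child j) (fillsAt L j ++ R j) (f j)) :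
    ∃ s', M.Visit q s (interleave θs (L.map Prod.snd)) q' s' ∧ s' [] = some g' ∧
      (∀ j, M.ChildRun (s'.child j) (R j) (f j)) ∧
      ∀ j, j ∈ seen ++ es.map (fun e => e.child) ↔ s'.child j [] ≠ none := by
  induction h generalizing s seen L with
  | @stay θ q q' g g' h =>
    obtain rfl : L = [] := List.map_eq_nil_iff.1 hL.symm
    refine ⟨_, h.visit_append hs (.nil _ _), by simp, fun j => ?_, fun j => ?_⟩
    · rw [Subtree.child_update]; exact hf j
    · simpa using forall_mem_seen_update hseen _ j
  | @gap e σ θ τ τ' θs es q q' g₁ g g₂ hσ hp hi ht hs' hp' hd _ ih =>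
    obtain _ | ⟨⟨e', w⟩, L⟩ := L
    · cases hL
    obtain ⟨rfl, rfl⟩ := List.cons.inj hL
    rw [List.zip_cons_cons, PushFirst, endsWithPush_append_singleton,
      PushFirst.cons_run (by rw [hd]; rintro ⟨_, _, ⟨⟩⟩)] at hpush
    obtain ⟨hpush1, hpush2⟩ := hpush
    have hc := hf e.child
    rw [fillsAt_cons_self, List.cons_append] at hc
    cases hc with
    | @cons _ b b' _ _ _ _ hab hv hb' hrest =>
    have hent : Subtree.Enter τ.1.instr e.child e.β (s.child e.child) b := by
      rcases hab with ⟨ha, hb⟩ | ⟨ha, hb⟩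
      · have h1 : e.child ∉ seen := by rw [hseen, ha]; simp [Subtree.empty]
        obtain ⟨n, γ, h2⟩ := hpush1.2 h1
        refine Or.inl ⟨hi.resolve_right ?_, ha, hb⟩
        rw [h2]; exact fun h => by cases h
      · have h1 : e.child ∈ seen := by rw [hseen, ha]; simp
        refine Or.inr ⟨hi.resolve_left ?_, ha, hb⟩
        exact fun h => hpush1.1 ⟨_, _, h⟩ h1
    set s₁ : Subtree Γ := Function.update s [] (some g) with hs₁
    have hsc : ∀ j, s₁.child j = s.child j := fun j => Subtree.child_update _ _ _
    obtain ⟨s', k1, k2, k3, k4⟩ := ih (s := s₁.graft e.child b') (by simp [hs₁])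
      (forall_mem_seen_graft (forall_mem_seen_update hseen (some g)) e.child (by simp [hb']))
      hpush2 rfl (fun j => by
        by_cases hj : j = e.child
        · subst hj; rwa [Subtree.child_graft_self]
        · rw [Subtree.child_graft_of_ne _ hj, hsc, ← fillsAt_cons_of_ne hj w]
          exact hf j)
    refine ⟨s', ?_, k2, k3, by simpa using k4⟩
    simp only [List.map_cons, interleave, interleave_cons_cons, List.append_assoc,
      List.singleton_append]
    exact hσ.visit_append hs (.excursion τ τ' (by simp) hp (by rw [← hs₁, hsc]; exact hent)
      (by rw [ht, hs']; exact hv) hb' hp' hd k1)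

theorem Visit.exists_admissible {M : TSA Q Γ α} {θ : List M.Trans} {q q' : Q} {s s' : Subtree Γ}
    (h : M.Visit q s θ q' s') {g : Sym Γ} (hs : s [] = some g) {seen : List ℕ+}
    (hseen : ∀ j, j ∈ seen ↔ s.child j [] ≠ none) :
    ∃ (θ₀ : List M.Trans) (θs : List (List M.Trans)) (L : List (Gap Q Γ × List M.Trans))
      (g' : Sym Γ), M.Admissible (θ₀ :: θs) (L.map Prod.fst) q q' g g' ∧ s' [] = some g' ∧
      interleave (θ₀ :: θs) (L.map Prod.snd) = θ ∧
      (∀ j, M.ChildRun (s.child j) (fillsAt L j) (s'.child j)) ∧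
      M.PushFirst seen ((θ₀ :: θs).zip (L.map Prod.fst)) ∧
      (∀ j, j ∈ seen ++ L.map (fun x => x.1.child) ↔ s'.child j [] ≠ none) ∧
      (∀ j, ((fillsAt L j).map fun x => x.2.length + 1).sum ≤ θ.length) ∧
      ∀ j π, ((fillsAt L j).map fun x =>
        (if π = [] then 1 else 0) + M.entryCount π [] x.2).sum ≤ M.entryCount (π ++ [j]) [] θ := by
  induction h generalizing g seen with
  | nil q s =>
    exact ⟨[], [], [], g, .stay (.nil q g), hs, rfl, fun j => .nil _, trivial, by simpa using hseen,
      by simp [fillsAt], by simp [fillsAt]⟩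
  | @stay τ s s' g₀ g₁ θ q' hs₀ hp hi hv ih =>
    obtain rfl : g₀ = g := Option.some.inj (hs₀.symm.trans hs)
    obtain ⟨θ₀, θs, L, g', h1, h2, h3, h4, h5, h6, h7, h8⟩ := ih (g := g₁) (by simp)
      (forall_mem_seen_update hseen _)
    refine ⟨τ :: θ₀, θs, L, g', h1.cons_stay hp hi, h2, by rw [interleave_cons_cons, h3],
      fun j => ?_, (PushFirst.cons_run hi.not_isPush).2 h5, h6, fun j => ?_, fun j π => ?_⟩
    · rw [← Subtree.child_update s j]; exact h4 j
    · exact (h7 j).trans (by simp)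
    · rw [entryCount_stay hi]; exact h8 j π
  | @excursion τ τ' s s' a a' g₀ j β β' w θ q' hs₀ hp he hw ha' hp' hd hv ih ih' =>
    clear ih
    obtain rfl : g₀ = g := Option.some.inj (hs₀.symm.trans hs)
    obtain ⟨θ₀, θs, L, g', h1, h2, h3, h4, h5, h6, h7, h8⟩ := ih' (g := g₀) (by simpa using hs)
      (forall_mem_seen_graft hseen j (by simp [ha']))
    set e : Gap Q Γ := ⟨τ.1.tgt, τ'.1.src, j, β, β'⟩ with hee
    have hej : e.child = j := rfl
    refine ⟨[τ], (τ' :: θ₀) :: θs, (e, w) :: L, g', ?_, h2, ?_, fun i => ?_, ?_, ?_, fun i => ?_,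
      fun i π => ?_⟩
    · refine Admissible.gap (σ := []) (.nil _ _) hp ?_ rfl rfl hp' hd h1
      rcases he with ⟨h, -⟩ | ⟨h, -⟩
      · exact Or.inl h
      · exact Or.inr h
    · simp [interleave, interleave_cons_cons, h3]
    · by_cases hi : i = e.child
      · have := h4 j
        rw [Subtree.child_graft_self] at this
        rw [hi, fillsAt_cons_self]
        refine .cons ?_ hw ha' this
        rcases he with ⟨-, h, h'⟩ | ⟨-, h, h'⟩
        · exact Or.inl ⟨h, h'⟩
        · exact Or.inr ⟨h, h'⟩
      · rw [fillsAt_cons_of_ne hi, ← Subtree.child_graft_of_ne s hi a']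
        exact h4 i
    · rw [List.map_cons, List.zip_cons_cons, PushFirst,
        PushFirst.cons_run (by rw [hd]; rintro ⟨_, _, ⟨⟩⟩)]
      refine ⟨?_, h5⟩
      rw [← List.nil_append [τ], endsWithPush_append_singleton]
      simp only [hej, hseen j]
      rcases he with ⟨h, ha, -⟩ | ⟨h, ha, -⟩
      · simp [h, ha, Subtree.empty, Instr.IsPush]
      · simp [h, ha, Instr.IsPush]
    · simpa using h6
    · have := h7 i
      by_cases hi : i = e.child
      · rw [hi] at this
        rw [hi, fillsAt_cons_self]
        simp only [List.map_cons, List.sum_cons, List.length_cons, List.length_append]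
        omega
      · rw [fillsAt_cons_of_ne hi]
        simp only [List.length_cons, List.length_append]
        omega
    · have := h8 i π
      rw [entryCount_enter he, hw.entryCount_append, entryCount_down hd]
      by_cases hi : i = e.child
      · rw [hi] at this
        rw [hi, fillsAt_cons_self]
        have hsh := hw.entryCount_shift π [] [j]
        rw [List.nil_append] at hsh
        have hif : [j] = π ++ [j] ↔ π = [] := by
          rw [eq_comm]; simp
        simp only [List.map_cons, List.sum_cons]
        rw [hej] at this ⊢
        rw [hsh]
        simp only [hif]
        omega
      · rw [fillsAt_cons_of_ne hi]
        omega

/-! ### Filled tuples -/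

/-- A tuple of runs together with its gaps and runs that fill these gaps. -/
abbrev FilledTuple (M : TSA Q Γ α) :=
  List (List M.Trans) × List (Gap Q Γ × List M.Trans)

/-- The tuple of runs and gaps in a filled tuple. -/
def FilledTuple.toGapTuple {M : TSA Q Γ α} (x : M.FilledTuple) : M.GapTuple :=
  ⟨x.1, x.2.map Prod.fst⟩

/-- The run that is obtained when the gaps are filled. -/
def FilledTuple.run {M : TSA Q Γ α} (x : M.FilledTuple) : List M.Trans :=
  interleave x.1 (x.2.map Prod.snd)

theorem map_fst_fillsAt {T : Type w} (L : List (Gap Q Γ × T)) (j : ℕ+) :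
    (fillsAt L j).map Prod.fst = (L.map Prod.fst).filter fun e => e.child = j := by
  rw [List.filter_map]; rfl

theorem allGaps_map_toGapTuple {M : TSA Q Γ α} (X : List M.FilledTuple) :
    M.allGaps (X.map FilledTuple.toGapTuple) = (X.flatMap Prod.snd).map Prod.fst := by
  rw [allGaps, List.flatMap_map, List.map_flatMap]; rfl

theorem gapsAt_map_toGapTuple {M : TSA Q Γ α} (X : List M.FilledTuple) (j : ℕ+) :
    M.gapsAt (X.map FilledTuple.toGapTuple) j = (fillsAt (X.flatMap Prod.snd) j).map Prod.fst := by
  rw [gapsAt, allGaps_map_toGapTuple, map_fst_fillsAt]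

theorem exists_filledTuples {M : TSA Q Γ α} (T : List M.GapTuple)
    (L : List (Gap Q Γ × List M.Trans)) (h : L.map Prod.fst = M.allGaps T) :
    ∃ X : List M.FilledTuple, X.map FilledTuple.toGapTuple = T ∧ X.flatMap Prod.snd = L := by
  induction T generalizing L with
  | nil =>
    obtain rfl : L = [] := List.map_eq_nil_iff.1 h
    exact ⟨[], rfl, rfl⟩
  | cons t T ih =>
    rw [allGaps, List.flatMap_cons, List.map_eq_append_iff] at h
    obtain ⟨L₁, L₂, rfl, h1, h2⟩ := h
    obtain ⟨X, rfl, rfl⟩ := ih L₂ h2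
    exact ⟨(t.runs, L₁) :: X, by simp [FilledTuple.toGapTuple, h1], by simp⟩

theorem mem_children {M : TSA Q Γ α} {T : List M.GapTuple} {j : ℕ+} :
    j ∈ M.children T ↔ ∃ e ∈ M.allGaps T, e.child = j := by
  simp [children]

theorem mem_children_iff_gapsAt {M : TSA Q Γ α} {T : List M.GapTuple} {j : ℕ+} :
    j ∈ M.children T ↔ M.gapsAt T j ≠ [] := by
  rw [mem_children, ne_eq, gapsAt, List.filter_eq_nil_iff]
  simp

theorem openings_cons {M : TSA Q Γ α} (t : M.GapTuple) (T : List M.GapTuple) :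
    M.openings (t :: T) = t.runs.zip t.gaps ++ M.openings T := rfl

theorem TupleType.map_child_zip {M : TSA Q Γ α} {θs : List (List M.Trans)} {es : List (Gap Q Γ)}
    {q₁ q₂ : Q} {g₁ g₂ : Sym Γ} (h : M.TupleType θs es q₁ q₂ g₁ g₂) :
    ((θs.zip es).map fun x => x.2.child) = es.map fun e => e.child := by
  have h1 := (tupleType_iff_admissible.1 h).length_runs
  have h2 := congrArg (List.map fun e => e.child) (List.map_snd_zip (l₁ := θs) (l₂ := es) (by omega))
  rwa [List.map_map] at h2

/-! ### Variables -/

/-- The string that is substituted for a variable. -/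
def varValue {T : Type w} (W : List (List (List T))) (y : ℕ × ℕ) : List T :=
  ((W[y.1]?).getD [])[y.2]?.getD []

theorem substitute_append {T : Type w} (W : List (List (List T))) (u u' : List (T ⊕ ℕ × ℕ)) :
    substitute W (u ++ u') = substitute W u ++ substitute W u' := List.flatMap_append

theorem substitute_map_inl {T : Type w} (W : List (List (List T))) (θ : List T) :
    substitute W (θ.map Sum.inl) = θ := by
  induction θ with
  | nil => rfl
  | cons t θ ih =>
    unfold substitute at *
    rw [List.map_cons, List.flatMap_cons, ih]; rfl

theorem substitute_weave {M : TSA Q Γ α} (W : List (List (List M.Trans)))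
    (θs : List (List M.Trans)) (ys : List (ℕ × ℕ)) :
    substitute W (M.weave θs ys) = interleave θs (ys.map (varValue W)) := by
  induction θs generalizing ys with
  | nil => cases ys <;> rfl
  | cons θ θs ih =>
    cases ys with
    | nil =>
      rw [weave, substitute_append, substitute_map_inl, ih, List.map_nil]
      rfl
    | cons y ys =>
      rw [weave, substitute_append, substitute_map_inl, List.map_cons, interleave, ← ih]
      rfl

theorem map_varValue_gapVars {T : Type w} (D : List ℕ+) (W : List (List (List T)))
    (L₁ L₂ L₃ : List (Gap Q Γ × List T))
    (h : ∀ x ∈ L₂, W[D.idxOf x.1.child]? =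
      some ((fillsAt (L₁ ++ L₂ ++ L₃) x.1.child).map Prod.snd)) :
    (gapVars D (L₁.map fun x => x.1.child) (L₂.map Prod.fst)).map (varValue W) =
      L₂.map Prod.snd := by
  induction L₂ generalizing L₁ with
  | nil => rfl
  | cons x L₂ ih =>
    have h1 := ih (L₁ ++ [x]) fun y hy => by
      simpa using h y (List.mem_cons_of_mem _ hy)
    rw [List.map_append] at h1
    rw [List.map_cons, gapVars, List.map_cons, List.map_cons]
    refine congrArg₂ _ ?_ h1
    obtain ⟨e, w⟩ := x
    have h2 : (L₁.map fun x => x.1.child).count e.child = (fillsAt L₁ e.child).length := by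
      rw [List.count, List.countP_map, List.countP_eq_length_filter, fillsAt]
      congr 1
    rw [varValue, h (e, w) (by simp), Option.getD_some, List.append_assoc, fillsAt_append,
      List.cons_append, fillsAt_cons_self, h2]
    simp

theorem map_substitute_ruleComps {M : TSA Q Γ α} (D : List ℕ+) (W : List (List (List M.Trans)))
    (L : List (Gap Q Γ × List M.Trans)) (X : List M.FilledTuple)
    (h : ∀ x ∈ X.flatMap Prod.snd, W[D.idxOf x.1.child]? =
      some ((fillsAt (L ++ X.flatMap Prod.snd) x.1.child).map Prod.snd)) :
    (M.ruleComps D (L.map fun x => x.1.child) (X.map FilledTuple.toGapTuple)).map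
      (substitute W) = X.map FilledTuple.run := by
  induction X generalizing L with
  | nil => rfl
  | cons x X ih =>
    rw [List.flatMap_cons] at h
    have h1 := ih (L ++ x.2) fun y hy => by
      rw [List.append_assoc]
      exact h y (List.mem_append_right _ hy)
    have h2 := map_varValue_gapVars D W L x.2 (X.flatMap Prod.snd) fun y hy => by
      rw [List.append_assoc]
      exact h y (List.mem_append_left _ hy)
    rw [List.map_append] at h1
    rw [List.map_cons, ruleComps, List.map_cons, List.map_cons, substitute_weave]
    refine congrArg₂ _ ?_ ?_
    · exact congrArg (interleave x.1) h2
    · rw [← h1, FilledTuple.toGapTuple, List.map_map]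
      rfl

theorem exists_fills {T : Type w} (V : ℕ+ → List (List T)) (seen : List ℕ+)
    (es : List (Gap Q Γ)) :
    ∃ L : List (Gap Q Γ × List T), L.map Prod.fst = es ∧
      ∀ j, (V j).length = (seen ++ es.map fun e => e.child).count j →
        (fillsAt L j).map Prod.snd = (V j).drop (seen.count j) := by
  induction es generalizing seen with
  | nil =>
    refine ⟨[], rfl, fun j hj => ?_⟩
    rw [List.map_nil, List.append_nil] at hj
    rw [← hj, List.drop_length]
    rfl
  | cons e es ih =>
    obtain ⟨L, rfl, h⟩ := ih (seen ++ [e.child])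
    refine ⟨(e, (V e.child)[seen.count e.child]?.getD []) :: L, rfl, fun j hj => ?_⟩
    have h1 := h j (by rw [hj]; simp)
    by_cases e1 : j = e.child
    · subst e1
      rw [fillsAt_cons_self, List.map_cons, h1]
      have h2 : seen.count e.child < (V e.child).length := by rw [hj]; simp
      rw [List.drop_eq_getElem_cons h2]
      simp [h2]
    · rw [fillsAt_cons_of_ne e1, h1]
      simp [List.count_append, Ne.symm e1]

/-! ### Sequences of visits and admissible sequences -/

theorem SeqType.exists_visitSeq {M : TSA Q Γ α} {X : List M.FilledTuple} {qs : List (Q × Q)}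
    {g : Sym Γ} {gs : List (Sym Γ)} (h : M.SeqType (X.map FilledTuple.toGapTuple) qs g gs)
    {s : Subtree Γ} (hs : s [] = some g) {seen : List ℕ+}
    (hseen : ∀ j, j ∈ seen ↔ s.child j [] ≠ none)
    (hpush : M.PushFirst seen (M.openings (X.map FilledTuple.toGapTuple))) {f : ℕ+ → Subtree Γ}
    (hf : ∀ j, M.ChildRun (s.child j) (fillsAt (X.flatMap Prod.snd) j) (f j)) :
    ∃ s', M.VisitSeq s qs gs (X.map FilledTuple.run) s' := by
  induction X generalizing qs g gs s seen with
  | nil => cases h; exact ⟨s, .nil s⟩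
  | cons x X ih =>
    rw [List.map_cons] at h hpush
    cases h with
    | cons ht hT =>
      rw [openings_cons, pushFirst_append, ht.map_child_zip] at hpush
      obtain ⟨s₁, h1, h2, h3, h4⟩ := (tupleType_iff_admissible.1 ht).exists_visit hs hseen hpush.1
        (L := x.2) rfl (R := fun j => fillsAt (X.flatMap Prod.snd) j) (f := f) (fun j => by
          rw [← fillsAt_append]; exact hf j)
      obtain ⟨s', h5⟩ := ih hT h2 h4 hpush.2 h3
      exact ⟨s', .cons h1 h2 h5⟩

theorem VisitSeq.exists_seqType {M : TSA Q Γ α} {s s' : Subtree Γ} {qs : List (Q × Q)}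
    {gs : List (Sym Γ)} {ws : List (List M.Trans)} (h : M.VisitSeq s qs gs ws s') {g : Sym Γ}
    (hs : s [] = some g) {seen : List ℕ+} (hseen : ∀ j, j ∈ seen ↔ s.child j [] ≠ none) :
    ∃ X : List M.FilledTuple, M.SeqType (X.map FilledTuple.toGapTuple) qs g gs ∧
      X.map FilledTuple.run = ws ∧
      (∀ j, M.ChildRun (s.child j) (fillsAt (X.flatMap Prod.snd) j) (s'.child j)) ∧
      M.PushFirst seen (M.openings (X.map FilledTuple.toGapTuple)) ∧
      (∀ j, ((fillsAt (X.flatMap Prod.snd) j).map fun x => x.2.length + 1).sum ≤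
        (ws.map List.length).sum) ∧
      ∀ j π, ((fillsAt (X.flatMap Prod.snd) j).map fun x =>
        (if π = [] then 1 else 0) + M.entryCount π [] x.2).sum ≤
        (ws.map (M.entryCount (π ++ [j]) [])).sum := by
  induction h generalizing g seen with
  | nil s =>
    exact ⟨[], .nil g, rfl, fun j => .nil _, trivial, by simp [fillsAt], by simp [fillsAt]⟩
  | cons hv hs₁ _ ih =>
    obtain ⟨θ₀, θs, L, g', h1, h2, h3, h4, h5, h6, h7, h8⟩ := hv.exists_admissible hs hseen
    obtain rfl := Option.some.inj (hs₁.symm.trans h2)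
    obtain ⟨X, k1, k2, k3, k4, k5, k6⟩ := ih hs₁ h6
    have ht := tupleType_iff_admissible.2 h1
    refine ⟨(θ₀ :: θs, L) :: X, .cons ht k1, ?_, fun j => ?_, ?_, fun j => ?_, fun j π => ?_⟩
    · rw [List.map_cons, k2, FilledTuple.run, h3]
    · rw [List.flatMap_cons, fillsAt_append]
      exact (h4 j).append (k3 j)
    · rw [List.map_cons, openings_cons, pushFirst_append, FilledTuple.toGapTuple, ht.map_child_zip,
        List.map_map]
      exact ⟨h5, k4⟩
    · rw [List.flatMap_cons, fillsAt_append, List.map_append, List.sum_append, List.map_cons,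
        List.sum_cons]
      exact Nat.add_le_add (h7 j) (k5 j)
    · rw [List.flatMap_cons, fillsAt_append, List.map_append, List.sum_append, List.map_cons,
        List.sum_cons]
      exact Nat.add_le_add (h8 j π) (k6 j π)

theorem childrenMatch_iff {M : TSA Q Γ α} {T : List M.GapTuple} :
    M.ChildrenMatch T ↔ M.PushFirst [] (M.openings T) ∧
      ∀ j, (M.gapsAt T j).IsChain fun e e' => e.β' = e'.β := by
  rw [ChildrenMatch, pushFirst_iff]
  simp

theorem SeqType.length_eq {M : TSA Q Γ α} {T : List M.GapTuple} {qs : List (Q × Q)}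
    {g : Sym Γ} {gs : List (Sym Γ)} (h : M.SeqType T qs g gs) :
    qs.length = T.length ∧ gs.length = T.length := by
  induction h with
  | nil => exact ⟨rfl, rfl⟩
  | cons _ _ ih => simpa using ih

theorem VisitSeq.length_eq {M : TSA Q Γ α} {s s' : Subtree Γ} {qs : List (Q × Q)}
    {gs : List (Sym Γ)} {ws : List (List M.Trans)} (h : M.VisitSeq s qs gs ws s') :
    ws.length = qs.length := by
  induction h with
  | nil => rfl
  | cons _ _ _ ih => simpa using ih

theorem states_gapNonterminal (es : List (Gap Q Γ)) :
    (gapNonterminal es).states = es.map fun e => (e.q, e.q') := rfl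

/-! ### The language of the run grammar -/

theorem exists_visitSeq_of_generates {M : TSA Q Γ α} {k : ℕ} {A : Nonterminal Q Γ}
    {ws : List (List M.Trans)} (h : (M.runGrammar k).Generates A ws) :
    ∃ g gs s', A.syms = g :: gs ∧ M.VisitSeq (Subtree.single g) A.states gs ws s' := by
  refine Grammar.Generates.induction (P := fun A ws =>
    ∃ g gs s', A.syms = g :: gs ∧ M.VisitSeq (Subtree.single g) A.states gs ws s') ?_ h
  rintro r ⟨T, qs, g, gs, -, -, -, hT, hmatch, rfl⟩ W hW
  refine ⟨g, gs, ?_⟩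
  simp only [true_and]
  dsimp only at W hW
  have hW' : ∀ j ∈ M.children T, ∃ V s', (List.ofFn W)[(M.children T).idxOf j]? = some V ∧
      M.VisitSeq (Subtree.single ((gapNonterminal (M.gapsAt T j)).syms.head?.getD .bot))
        (gapNonterminal (M.gapsAt T j)).states (gapNonterminal (M.gapsAt T j)).syms.tail V s' := by
    intro j hj
    have hi := List.idxOf_lt_length_of_mem hj
    obtain ⟨g, gs, s', h1, h2⟩ := (hW ⟨(M.children T).idxOf j, by simpa using hi⟩).2
    simp only [List.get_eq_getElem, List.getElem_map, List.getElem_idxOf] at h1 h2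
    refine ⟨_, s', ?_, by rw [h1]; exact h2⟩
    rw [List.getElem?_ofFn, dif_pos (by simpa using hi)]
  set V : ℕ+ → List (List M.Trans) := fun j =>
    ((List.ofFn W)[(M.children T).idxOf j]?).getD [] with hV
  obtain ⟨L, hL, hfill⟩ := exists_fills V [] (M.allGaps T)
  obtain ⟨X, rfl, rfl⟩ := exists_filledTuples T L hL
  have hgaps := gapsAt_map_toGapTuple X
  have hfill' : ∀ j ∈ M.children (X.map FilledTuple.toGapTuple),
      (fillsAt (X.flatMap Prod.snd) j).map Prod.snd = V j := by
    intro j hj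
    obtain ⟨V', s', h1, h2⟩ := hW' j hj
    have h3 := hfill j ?_
    · simpa using h3
    · have h4 := h2.length_eq
      have h5 : V j = V' := by simp only [hV, h1, Option.getD_some]
      rw [h5, h4, states_gapNonterminal, List.length_map, gapsAt, List.nil_append, List.count,
        List.countP_map, List.countP_eq_length_filter]
      congr 1
  have hcomps : (M.ruleComps (M.children (X.map FilledTuple.toGapTuple)) []
      (X.map FilledTuple.toGapTuple)).map (substitute (List.ofFn W)) =
      X.map FilledTuple.run := by
    refine map_substitute_ruleComps _ _ [] X fun x hx => ?_
    have hj : x.1.child ∈ M.children (X.map FilledTuple.toGapTuple) :=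
      mem_children.2 ⟨x.1, by rw [hL.symm]; exact List.mem_map_of_mem hx, rfl⟩
    obtain ⟨V', s', h1, -⟩ := hW' _ hj
    rw [List.nil_append, hfill' _ hj, hV]
    simp only [h1, Option.getD_some]
  rw [hcomps]
  have hchild : ∀ j, ∃ a, M.ChildRun Subtree.empty (fillsAt (X.flatMap Prod.snd) j) a := by
    intro j
    rcases hc : fillsAt (X.flatMap Prod.snd) j with _ | ⟨⟨e, w⟩, L⟩
    · exact ⟨_, .nil _⟩
    · have hj : j ∈ M.children (X.map FilledTuple.toGapTuple) := by
        rw [mem_children_iff_gapsAt, hgaps, hc]; simp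
      obtain ⟨V', s', h1, h2⟩ := hW' j hj
      have h3 : V' = V j := by simp only [hV, h1, Option.getD_some]
      have h4 := (childrenMatch_iff.1 hmatch).2 j
      rw [h3, ← hfill' j hj, hgaps, hc] at h2
      rw [hgaps, hc] at h4
      exact ⟨s', childRun_empty_cons_iff.2 ⟨h4, h2⟩⟩
  choose f hf using hchild
  exact hT.exists_visitSeq (Subtree.single_nil g) (seen := []) (by simp [Subtree.empty])
    (childrenMatch_iff.1 hmatch).1 (by simpa using hf)

theorem VisitSeq.generates {M : TSA Q Γ α} {k : ℕ} (n : ℕ) {g : Sym Γ} {s' : Subtree Γ}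
    {qs : List (Q × Q)} {gs : List (Sym Γ)} {ws : List (List M.Trans)}
    (h : M.VisitSeq (Subtree.single g) qs gs ws s') (hn : (ws.map List.length).sum < n)
    (hne : ws ≠ []) (hk : ws.length ≤ k)
    (hcount : ∀ π, π ≠ [] → (ws.map (M.entryCount π [])).sum ≤ k) :
    (M.runGrammar k).Generates ⟨qs, g :: gs⟩ ws := by
  induction n generalizing g s' qs gs ws with
  | zero => omega
  | succ n ih =>
    obtain ⟨X, h1, h2, h3, h4, h5, h6⟩ := h.exists_seqType (Subtree.single_nil g) (seen := [])
      (by simp [Subtree.empty])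
    simp only [Subtree.child_single] at h3
    have hgaps := gapsAt_map_toGapTuple X
    have hlen : ∀ j, (M.gapsAt (X.map FilledTuple.toGapTuple) j).length ≤ k := by
      intro j
      refine le_trans ?_ ((h6 j []).trans (hcount ([] ++ [j]) (by simp)))
      rw [hgaps, List.length_map, List.sum_map_add]
      simp
    have hchain : ∀ j, (M.gapsAt (X.map FilledTuple.toGapTuple) j).IsChain
        fun e e' => e.β' = e'.β := by
      intro j
      rw [hgaps]
      have := h3 j
      rcases hc : fillsAt (X.flatMap Prod.snd) j with _ | ⟨⟨e, w⟩, L⟩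
      · simp
      · rw [hc] at this
        exact (childRun_empty_cons_iff.1 this).1
    have hr : _ ∈ (M.runGrammar k).rules :=
      ⟨X.map FilledTuple.toGapTuple, qs, g, gs, by rintro h0; simp_all, by simpa [← h2] using hk,
        hlen, h1, childrenMatch_iff.2 ⟨h4, hchain⟩, rfl⟩
    have hgen := Grammar.Generates.of_rule hr
      (fun i => (fillsAt (X.flatMap Prod.snd)
        ((M.children (X.map FilledTuple.toGapTuple))[i.1]'(by simpa using i.2))).map Prod.snd) ?_
    · rw [← h2]
      convert hgen using 1
      · refine (map_substitute_ruleComps _ _ [] X fun x hx => ?_).symm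
        have hj : x.1.child ∈ M.children (X.map FilledTuple.toGapTuple) :=
          mem_children.2 ⟨x.1, by
            rw [allGaps_map_toGapTuple]; exact List.mem_map_of_mem hx, rfl⟩
        have hi := List.idxOf_lt_length_of_mem hj
        rw [List.getElem?_ofFn, dif_pos (by simpa using hi)]
        simp
    · rintro ⟨i, hi⟩
      simp only [List.length_map] at hi
      simp only [List.get_eq_getElem, List.getElem_map]
      generalize hj : (M.children (X.map FilledTuple.toGapTuple))[i] = j
      have hmem : j ∈ M.children (X.map FilledTuple.toGapTuple) := hj ▸ List.getElem_mem hi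
      rw [mem_children_iff_gapsAt] at hmem
      have hlenj := hlen j
      rw [hgaps] at hmem hlenj ⊢
      have h3j := h3 j
      have h5j := h5 j
      have h6j := h6 j
      rcases hc : fillsAt (X.flatMap Prod.snd) j with _ | ⟨⟨e, w⟩, L⟩
      · rw [hc] at hmem; simp at hmem
      · rw [hc] at h3j h5j h6j hlenj
        refine ih (childRun_empty_cons_iff.1 h3j).2 ?_ (by simp) (by simpa using hlenj) ?_
        · rw [List.sum_map_add] at h5j
          simp only [List.map_map, List.map_cons, List.sum_cons,
            List.map_const', List.sum_replicate, Function.comp_def] at h5j ⊢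
          simp only [smul_eq_mul] at h5j
          omega
        · intro π hπ
          refine le_trans ?_ ((h6j π).trans (hcount (π ++ [j]) (by simp)))
          simp [hπ, Function.comp_def]

theorem language_runGrammar {M : TSA Q Γ α} {k : ℕ} (hk : 1 ≤ k) (hrestr : M.IsRestricted k)
    (hsnf : M.InStackNormalForm) : (M.runGrammar k).language = M.validRuns := by
  ext θ
  rw [Grammar.mem_language]
  constructor
  · rintro ⟨_, ⟨q, hq, rfl⟩, hgen⟩
    obtain ⟨g, gs, s', h1, h2⟩ := exists_visitSeq_of_generates hgen
    obtain ⟨rfl, rfl⟩ := List.cons.inj h1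
    cases h2 with
    | cons h3 h4 _ => exact (mem_validRuns_iff hsnf).2 ⟨q, hq, _, h4, h3⟩
  · intro hθ
    obtain ⟨q, hq, s, hs, hv⟩ := (mem_validRuns_iff hsnf).1 hθ
    refine ⟨_, ⟨q, hq, rfl⟩, VisitSeq.generates _ (.cons hv hs (.nil s)) (Nat.lt_succ_self _)
      (by simp) (by simpa using hk) fun π _ => ?_⟩
    simpa using hrestr θ hθ π

/-! ### Linearity and well-sortedness of the run grammar -/

theorem gapVars_append (D seen : List ℕ+) (es es' : List (Gap Q Γ)) :
    gapVars D seen (es ++ es') =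
      gapVars D seen es ++ gapVars D (seen ++ es.map fun e => e.child) es' := by
  induction es generalizing seen with
  | nil => simp [gapVars]
  | cons e es ih => simp [gapVars, ih]

theorem length_gapVars (D seen : List ℕ+) (es : List (Gap Q Γ)) :
    (gapVars D seen es).length = es.length := by
  induction es generalizing seen with
  | nil => rfl
  | cons e es ih => simp [gapVars, ih]

theorem mem_gapVars {D seen : List ℕ+} {es : List (Gap Q Γ)} {y : ℕ × ℕ}
    (h : y ∈ gapVars D seen es) : ∃ e ∈ es, y.1 = D.idxOf e.child ∧ seen.count e.child ≤ y.2 ∧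
      y.2 < (seen ++ es.map fun e => e.child).count e.child := by
  induction es generalizing seen with
  | nil => cases h
  | cons e es ih =>
    rcases List.mem_cons.1 h with rfl | h
    · refine ⟨e, by simp, rfl, le_rfl, ?_⟩
      simp
    · obtain ⟨e', h1, h2, h3, h4⟩ := ih h
      refine ⟨e', by simp [h1], h2, le_trans ?_ h3, by simpa using h4⟩
      simp

theorem nodup_gapVars {D seen : List ℕ+} {es : List (Gap Q Γ)} (h : ∀ e ∈ es, e.child ∈ D) :
    (gapVars D seen es).Nodup := by
  induction es generalizing seen with
  | nil => exact List.nodup_nil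
  | cons e es ih =>
    refine List.nodup_cons.2 ⟨fun hmem => ?_, ih fun e' h' => h e' (by simp [h'])⟩
    obtain ⟨e', h1, h2, h3, -⟩ := mem_gapVars hmem
    have h4 : e.child = e'.child := (List.idxOf_inj (h e (by simp))).1 h2
    rw [← h4] at h3
    simp at h3

theorem filterMap_weave {M : TSA Q Γ α} (θs : List (List M.Trans)) (ys : List (ℕ × ℕ))
    (h : ys.length ≤ θs.length) : (M.weave θs ys).filterMap Sum.getRight? = ys := by
  have hinl : ∀ θ : List M.Trans,
      (θ.map (Sum.inl (β := ℕ × ℕ))).filterMap Sum.getRight? = [] := by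
    intro θ
    simp
  induction θs generalizing ys with
  | nil =>
    obtain rfl : ys = [] := by simpa using h
    rfl
  | cons θ θs ih =>
    cases ys with
    | nil => rw [weave, List.filterMap_append, hinl, ih _ (by simp)]; rfl
    | cons y ys =>
      rw [weave, List.filterMap_append, hinl, List.nil_append,
        List.filterMap_cons_some (f := Sum.getRight?) (b := y) rfl, ih _ (by simpa using h)]

theorem filterMap_ruleComps {M : TSA Q Γ α} (D seen : List ℕ+) (T : List M.GapTuple)
    (h : ∀ t ∈ T, t.gaps.length ≤ t.runs.length) :
    (M.ruleComps D seen T).flatten.filterMap Sum.getRight? = gapVars D seen (M.allGaps T) := by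
  induction T generalizing seen with
  | nil => rfl
  | cons t T ih =>
    rw [ruleComps, List.flatten_cons, List.filterMap_append, filterMap_weave _ _
      (by rw [length_gapVars]; exact h t (by simp)), ih _ fun t' h' => h t' (by simp [h']),
      allGaps, allGaps, List.flatMap_cons, gapVars_append]

theorem length_ruleComps {M : TSA Q Γ α} (D seen : List ℕ+) (T : List M.GapTuple) :
    (M.ruleComps D seen T).length = T.length := by
  induction T generalizing seen with
  | nil => rfl
  | cons t T ih => simp [ruleComps, ih]

theorem SeqType.exists_admissible {M : TSA Q Γ α} {T : List M.GapTuple} {qs : List (Q × Q)}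
    {g : Sym Γ} {gs : List (Sym Γ)} (h : M.SeqType T qs g gs) {t : M.GapTuple} (ht : t ∈ T) :
    ∃ q q' g g', M.Admissible t.runs t.gaps q q' g g' := by
  induction h with
  | nil => cases ht
  | cons h _ ih =>
    rcases List.mem_cons.1 ht with rfl | ht
    · exact ⟨_, _, _, _, tupleType_iff_admissible.1 h⟩
    · exact ih ht

theorem SeqType.filterMap_ruleComps {M : TSA Q Γ α} {T : List M.GapTuple} {qs : List (Q × Q)}
    {g : Sym Γ} {gs : List (Sym Γ)} (h : M.SeqType T qs g gs) (D seen : List ℕ+) :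
    (M.ruleComps D seen T).flatten.filterMap Sum.getRight? = gapVars D seen (M.allGaps T) := by
  refine TSA.filterMap_ruleComps D seen T fun t ht => ?_
  obtain ⟨_, _, _, _, h1⟩ := h.exists_admissible ht
  have := h1.length_runs
  omega

theorem length_gapsAt {M : TSA Q Γ α} (T : List M.GapTuple) (j : ℕ+) :
    (M.gapsAt T j).length = ((M.allGaps T).map fun e => e.child).count j := by
  rw [gapsAt, List.count, List.countP_map, List.countP_eq_length_filter]
  congr 1

/-! ### Finiteness of the run grammar -/

theorem finite_lists {β : Type w} {S : Set β} (hS : S.Finite) (n : ℕ) :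
    {l : List β | l.length ≤ n ∧ ∀ x ∈ l, x ∈ S}.Finite := by
  have := hS.to_subtype
  refine ((List.finite_length_le S n).image (List.map (fun x : S => (x : β)))).subset ?_
  rintro l ⟨hl, hlS⟩
  have h1 : l ∈ Set.range (List.map (fun x : S => (x : β))) := by
    rw [Set.range_list_map_coe]; exact hlS
  obtain ⟨l', rfl⟩ := h1
  exact ⟨l', by simpa using hl, rfl⟩

theorem Admissible.child_mem {M : TSA Q Γ α} {θs : List (List M.Trans)} {es : List (Gap Q Γ)}
    {q q' : Q} {g g' : Sym Γ} (h : M.Admissible θs es q q' g g') :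
    ∀ e ∈ es, e.child ∈ M.trans.image fun τ => τ.instr.childIndex := by
  induction h with
  | stay => simp
  | @gap e σ θ τ τ' _ _ _ _ _ _ _ _ _ hi _ _ _ _ _ ih =>
    refine List.forall_mem_cons.2 ⟨Finset.mem_image.2 ⟨τ.1, τ.2, ?_⟩, ih⟩
    rcases hi with hi | hi <;> rw [hi] <;> rfl

theorem Admissible.length_le {M : TSA Q Γ α} {n : ℕ}
    (hn : ∀ {q q' g g' θ}, M.StayRun q g θ q' g' → θ.length ≤ n) {θs : List (List M.Trans)}
    {es : List (Gap Q Γ)} {q q' : Q} {g g' : Sym Γ} (h : M.Admissible θs es q q' g g') :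
    (∀ θ ∈ θs.head?, θ.length ≤ n + 1) ∧ ∀ θ ∈ θs.tail, θ.length ≤ n + 2 := by
  induction h with
  | stay h => simpa using (hn h).trans (Nat.le_succ n)
  | gap h _ _ _ _ _ _ _ ih =>
    have := hn h
    simp only [List.head?_cons, Option.mem_def, Option.some.injEq, forall_eq', List.tail_cons] at ih
    simp only [List.head?_cons, Option.mem_def, Option.some.injEq, forall_eq', List.tail_cons,
      List.forall_mem_cons, List.length_append, List.length_cons, List.length_nil]
    exact ⟨by omega, by omega, ih.2⟩

theorem finite_gaps [Finite Q] [Finite Γ] (J : Finset ℕ+) :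
    {e : Gap Q Γ | e.child ∈ J}.Finite := by
  refine (Set.finite_range fun x : Q × Q × J × Γ × Γ =>
    (⟨x.1, x.2.1, x.2.2.1, x.2.2.2.1, x.2.2.2.2⟩ : Gap Q Γ)).subset ?_
  rintro ⟨q, q', j, β, β'⟩ h
  exact ⟨(q, q', ⟨j, h⟩, β, β'), rfl⟩

theorem finite_gapTuples [Finite Q] [Finite Γ] {M : TSA Q Γ α} (hM : M.IsCycleFree) (n : ℕ) :
    {t : M.GapTuple | t.gaps.length ≤ n ∧
      ∃ q q' g g', M.Admissible t.runs t.gaps q q' g g'}.Finite := by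
  set N := Nat.card (Q × Sym Γ)
  have h1 := finite_lists (List.finite_length_le M.Trans (N + 2)) (n + 1)
  have h2 := finite_lists (finite_gaps (Q := Q) (Γ := Γ)
    (M.trans.image fun τ => τ.instr.childIndex)) n
  refine ((h1.prod h2).image fun x => (⟨x.1, x.2⟩ : M.GapTuple)).subset ?_
  rintro ⟨θs, es⟩ ⟨hes, q, q', g, g', h⟩
  refine ⟨(θs, es), ⟨⟨?_, ?_⟩, hes, h.child_mem⟩, rfl⟩
  · rw [h.length_runs]; exact Nat.succ_le_succ hes
  · obtain ⟨h3, h4⟩ := h.length_le (n := N) fun hσ => (hσ.length_lt hM).le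
    intro θ hθ
    cases θs with
    | nil => cases hθ
    | cons θ₀ θs =>
      rcases List.mem_cons.1 hθ with rfl | hθ
      · exact (h3 θ rfl).trans (Nat.le_succ _)
      · exact h4 θ hθ

theorem finite_runRules [Finite Q] [Finite Γ] {M : TSA Q Γ α} (hM : M.IsCycleFree) (k : ℕ) :
    (M.runRules k).Finite := by
  set J := M.trans.image fun τ => τ.instr.childIndex with hJ
  have hT := finite_lists (finite_gapTuples hM (J.card * k)) k
  refine ((((hT.prod (List.finite_length_le (Q × Q) k)).prod (Set.toFinite Set.univ)).prod
    (List.finite_length_le (Sym Γ) k)).image fun x : ((List M.GapTuple × List (Q × Q)) × Sym Γ) ×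
      List (Sym Γ) => (⟨⟨x.1.1.2, x.1.2 :: x.2⟩, M.ruleComps (M.children x.1.1.1) [] x.1.1.1,
        (M.children x.1.1.1).map fun j => gapNonterminal (M.gapsAt x.1.1.1 j)⟩ :
        Rule (Nonterminal Q Γ) M.Trans)).subset ?_
  rintro r ⟨T, qs, g, gs, -, hlen, hgaps, hseq, -, rfl⟩
  refine ⟨(((T, qs), g), gs), ⟨⟨⟨⟨hlen, fun t ht => ⟨?_, hseq.exists_admissible ht⟩⟩, ?_⟩,
    Set.mem_univ _⟩, ?_⟩, rfl⟩
  · have h1 : t.gaps.length ≤ (M.allGaps T).length := by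
      rw [allGaps, List.length_flatMap]
      exact List.le_sum_of_mem (List.mem_map.2 ⟨t, ht, rfl⟩)
    refine h1.trans ?_
    have h2 : ∀ j ∈ ((M.allGaps T).map fun e => e.child : Multiset ℕ+), j ∈ J := by
      intro j hj
      obtain ⟨e, he, rfl⟩ := List.mem_map.1 (Multiset.mem_coe.1 hj)
      obtain ⟨t', ht', he'⟩ := List.mem_flatMap.1 he
      obtain ⟨_, _, _, _, h⟩ := hseq.exists_admissible ht'
      exact h.child_mem e he'
    have h3 := Multiset.sum_count_eq_card h2
    rw [Multiset.coe_card, List.length_map] at h3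
    rw [← h3]
    refine Finset.sum_le_card_nsmul _ _ _ fun j _ => ?_
    rw [Multiset.coe_count, ← length_gapsAt]
    exact hgaps j
  · exact hseq.length_eq.1.trans_le hlen
  · exact hseq.length_eq.2.trans_le hlen

theorem finite_nonterminals_runGrammar [Finite Q] [Finite Γ] {M : TSA Q Γ α}
    (hM : M.IsCycleFree) (k : ℕ) : (M.runGrammar k).nonterminals.Finite := by
  refine Set.Finite.union ?_ ?_
  · refine (Set.finite_range fun q : Q =>
      (⟨[(M.start, q)], [Sym.bot, Sym.bot]⟩ : Nonterminal Q Γ)).subset ?_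
    rintro A ⟨q, -, rfl⟩
    exact ⟨q, rfl⟩
  · refine ((finite_runRules hM k).biUnion fun r _ => (r.lhs :: r.rhs).finite_toSet).subset ?_
    rintro A ⟨r, hr, hA⟩
    exact Set.mem_biUnion hr (List.mem_cons.2 hA)

theorem isMCFG_runGrammar [Finite Q] [Finite Γ] {M : TSA Q Γ α} (hM : M.IsCycleFree) (k : ℕ) :
    (M.runGrammar k).IsMCFG k where
  finite_terminals := inferInstanceAs (Finite M.Trans)
  finite_nonterminals := finite_nonterminals_runGrammar hM k
  sort_pos := by
    rintro A (⟨q, -, rfl⟩ | ⟨r, ⟨T, qs, g, gs, hne, -, -, hseq, -, rfl⟩, rfl | hA⟩)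
    · exact Nat.one_pos
    · exact (List.length_pos_of_ne_nil hne).trans_eq hseq.length_eq.1.symm
    · obtain ⟨j, hj, rfl⟩ := List.mem_map.1 hA
      show 0 < (gapNonterminal (M.gapsAt T j)).states.length
      rw [states_gapNonterminal, List.length_map]
      exact List.length_pos_of_ne_nil (mem_children_iff_gapsAt.1 hj)
  initial_subset := Set.subset_union_left
  sort_initial := by
    rintro A ⟨q, -, rfl⟩
    rfl
  finite_rules := finite_runRules hM k
  lhs_mem r hr := Or.inr ⟨r, hr, Or.inl rfl⟩
  rhs_mem r hr B hB := Or.inr ⟨r, hr, Or.inr hB⟩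
  length_comps := by
    rintro r ⟨T, qs, g, gs, -, -, -, hseq, -, rfl⟩
    exact (length_ruleComps _ _ _).trans hseq.length_eq.1.symm
  variables_mem := by
    rintro r ⟨T, qs, g, gs, -, -, -, hseq, -, rfl⟩ u hu i j hij
    have h1 : (i, j) ∈ (M.ruleComps (M.children T) [] T).flatten.filterMap Sum.getRight? :=
      List.mem_filterMap.2 ⟨_, List.mem_flatten.2 ⟨u, hu, hij⟩, rfl⟩
    rw [hseq.filterMap_ruleComps] at h1
    obtain ⟨e, he, h2, -, h3⟩ := mem_gapVars h1
    simp only [List.nil_append] at h2 h3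
    have hmem : e.child ∈ M.children T := mem_children.2 ⟨e, he, rfl⟩
    refine ⟨gapNonterminal (M.gapsAt T e.child), ?_, ?_⟩
    · simp [h2, List.getElem?_idxOf hmem]
    · show j < (gapNonterminal (M.gapsAt T e.child)).states.length
      rwa [states_gapNonterminal, List.length_map, length_gapsAt]
  linear := by
    rintro r ⟨T, qs, g, gs, -, -, -, hseq, -, rfl⟩
    rw [hseq.filterMap_ruleComps]
    exact nodup_gapVars fun e he => mem_children.2 ⟨e, he, rfl⟩
  fanout_le := by
    rintro r ⟨T, qs, g, gs, -, hlen, -, -, -, rfl⟩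
    exact (length_ruleComps _ _ _).trans_le hlen

end TSA

end TreeStackAutomata

theorem mainTheorem2 {Q : Type*} {Γ : Type*} {α : Type*} [Finite Q] [Finite Γ] [Finite α]
    (k : ℕ) (hk : 1 ≤ k) (M : TreeStackAutomata.TSA Q Γ α)
    (hcycle : M.IsCycleFree) (hrestr : M.IsRestricted k) (hsnf : M.InStackNormalForm) :
    (M.runGrammar k).IsMCFG k ∧
    (M.runGrammar k).language = M.validRuns ∧
    (M.wordGrammar k).IsMCFG k ∧
    (M.wordGrammar k).language = {w | ∃ θ ∈ (M.runGrammar k).language, M.word θ = w} ∧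
    M.language = (M.wordGrammar k).language := by
  have h1 := TreeStackAutomata.TSA.isMCFG_runGrammar hcycle k
  have h2 := TreeStackAutomata.TSA.language_runGrammar hk hrestr hsnf
  have h3 : (M.wordGrammar k).language = {w | ∃ θ ∈ (M.runGrammar k).language, M.word θ = w} :=
    TreeStackAutomata.Grammar.language_mapTerminals _ _
  refine ⟨h1, h2, h1.mapTerminals _, h3, ?_⟩
  rw [h3, h2]
  rfl
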